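/- Let $k$ be a field of characteristic $p>0$ and let $Q$ be a finite quiver with vertex set $Q_0$, arrow set $Q_1$ and source and target maps $s,t$ (vertices are the paths of length $0$; paths are written from right to left). Let $Z$ be a set of paths of length at least two such that no strict subpath of a path of $Z$ is in $Z$, and let $A=kQ/\langle Z\rangle$ be the corresponding monomial algebra. Let $B$ be the set of paths which contain no path of $Z$. For sets of paths $X,Y$ let $X\odot Y=\{(\alpha,\beta)\in X\times Y:\ t(\beta)=s(\alpha),\ t(\alpha)=s(\beta)\}$. A *circuit* is an equivalence class of cycles (paths $\gamma$ with $s(\gamma)=t(\gamma)$, vertices included) for the relation generated by rotation $\gamma_n\cdots\gamma_1\sim\gamma_1\gamma_n\cdots\gamma_2$; it is *trivial* if it is the class of a vertex. Let $(X\odot Y)_C$ be the set of $(\alpha,\beta)\in X\odot Y$ with $\alpha\beta\in C$. If a circuit $C$ consists of cycles of length $n\ge 1$ and $l\geq 1$ is the smallest integer such that the $l$-th rotated of a cycle of $C$ is this cycle itself, then the *multiplicity* of $C$ is $n/l$. A circuit $C$ is *strong* if all its cycles are in $B$, and *efficient* if it is not strong, $(Q_1\odot B)_C\neq\emptyset$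 and $(Z\odot B)_C\ne\emptyset$. Let $\mathcal E$ be the set of efficient circuits, $e_{p'}$ the number of efficient circuits whose multiplicity is not divisible by $p$, and $s$ the number of non-trivial strong circuits. Let $W$ be the set of cycles which contain precisely one path of $Z$ (occurrences being counted with their position), located at the end of the cycle, i.e. $\gamma=\xi\alpha$ with $\xi\in Z$ and no other occurrence in $\gamma$ of a path of $Z$; put $w_C=|W\cap C|$, a finite number. If $A$ is finite-dimensional, then $\mathcal E$, $Q_1\odot B$, $Q_0\odot B$ and the set of strong circuits which are not trivial are finite, and the first Hochschild homology $HH_1(A)$ is finite-dimensional with $$\dim_k HH_1(A)=s+\sum_{C\in\mathcal E}w_C-e_{p'}=|Q_1\odot B|-|Q_0\odot B|+|Q_0|-e_{p'}+s .$$ Whether or not $A$ is finite-dimensional, the following equalities of cardinal numbers hold: $$\dim_k HH_1(A)+e_{p'}=s+\sum_{C\in\mathcal E}w_C,\qquad \dim_k HH_1(A)+|Q_0\odot B|+e_{p'}=|Q_1\odot B|+|Q_0|+s .$$ -/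

import Mathlib

universe u v w

namespace HochMon

open Quiver

/-! ### Paths, subpaths and the path algebra -/

/-- A path of the quiver `V` together with its end points. A length zero path is a vertex. -/
structure QPath (V : Type v) [Quiver.{w} V] where
  /-- source of the path -/
  src : V
  /-- target of the path -/
  tgt : V
  /-- the sequence of arrows -/
  path : Path src tgt

section Paths

variable {V : Type v} [Quiver.{w} V]

/-- The path which first runs through `α` and then through `β`; it is written `βα` in the
right-to-left notation for paths. -/
def QPath.comp (α β : QPath V) (h : α.tgt = β.src) : QPath V :=
  ⟨α.src, β.tgt, α.path.comp (β.path.cast h.symm rfl)⟩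

/-- The number of arrows of a path. -/
def QPath.length (α : QPath V) : ℕ := α.path.length

/-- The trivial path at a vertex. -/
def QPath.nil (a : V) : QPath V := ⟨a, a, Path.nil⟩

/-- `δ` is a subpath of `γ`, that is, `γ = β δ α` for some paths `α` and `β`. -/
def QPath.IsSubpath (δ γ : QPath V) : Prop :=
  ∃ (α : Path γ.src δ.src) (β : Path δ.tgt γ.tgt), γ.path = (α.comp δ.path).comp β

theorem QPath.comp_assoc (α β γ : QPath V) (h₁ : α.tgt = β.src) (h₂ : β.tgt = γ.src) :
    (α.comp β h₁).comp γ h₂ = α.comp (β.comp γ h₂) h₁ := by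
  obtain ⟨a, b, p⟩ := α
  obtain ⟨c, d, q⟩ := β
  obtain ⟨e, f, r⟩ := γ
  dsimp only at h₁ h₂
  subst h₁ h₂
  simp [QPath.comp, Path.comp_assoc]

theorem QPath.nil_comp (α : QPath V) (a : V) (h : a = α.src) :
    (QPath.nil a).comp α h = α := by
  obtain ⟨b, c, p⟩ := α
  dsimp only at h
  subst h
  simp [QPath.comp, QPath.nil]

theorem QPath.comp_nil (α : QPath V) (a : V) (h : α.tgt = a) :
    α.comp (QPath.nil a) h = α := by
  subst h
  obtain ⟨b, c, p⟩ := α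
  simp [QPath.comp, QPath.nil]

end Paths

/-- The path algebra `kQ`: the vector space with basis the set of all paths. -/
def PathAlgebra (k : Type u) (V : Type v) [Quiver.{w} V] [Field k] : Type max u v w :=
  QPath V →₀ k

namespace PathAlgebra

noncomputable section

variable {k : Type u} {V : Type v} [Quiver.{w} V] [Field k]

instance : AddCommGroup (PathAlgebra k V) := inferInstanceAs (AddCommGroup (QPath V →₀ k))

instance : Module k (PathAlgebra k V) := inferInstanceAs (Module k (QPath V →₀ k))

/-- The basis element of `kQ` given by a path. -/
def ofPath (α : QPath V) : PathAlgebra k V := Finsupp.single α (1 : k)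

/-- The paths form a basis of `kQ`. -/
def basis (k : Type u) (V : Type v) [Quiver.{w} V] [Field k] :
    Module.Basis (QPath V) k (PathAlgebra k V) :=
  ⟨LinearEquiv.refl k (QPath V →₀ k)⟩

theorem basis_apply (α : QPath V) : basis k V α = ofPath α := rfl

open Classical in
/-- The product `β α` of two paths in `kQ`: the concatenation if `t(α) = s(β)`, and zero
otherwise. -/
def mulPath (β α : QPath V) : PathAlgebra k V :=
  if h : α.tgt = β.src then ofPath (α.comp β h) else 0

/-- The bilinear extension of the product of paths. -/
def mulHom (k : Type u) (V : Type v) [Quiver.{w} V] [Field k] :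
    PathAlgebra k V →ₗ[k] PathAlgebra k V →ₗ[k] PathAlgebra k V :=
  (basis k V).constr k fun β => (basis k V).constr k fun α => mulPath β α

instance : Mul (PathAlgebra k V) := ⟨fun x y => mulHom k V x y⟩

theorem mul_def (x y : PathAlgebra k V) : x * y = mulHom k V x y := rfl

theorem ofPath_mul_ofPath (β α : QPath V) :
    (ofPath β * ofPath α : PathAlgebra k V) = mulPath β α := by
  rw [mul_def, ← basis_apply, ← basis_apply, mulHom, Module.Basis.constr_basis,
    Module.Basis.constr_basis]

instance [Fintype V] : One (PathAlgebra k V) := ⟨∑ a : V, ofPath (QPath.nil a)⟩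

theorem one_def [Fintype V] : (1 : PathAlgebra k V) = ∑ a : V, ofPath (QPath.nil a) := rfl

theorem mulPath_assoc (γ β α : QPath V) :
    mulHom k V (mulPath γ β) (ofPath α) = mulHom k V (ofPath γ) (mulPath β α) := by
  by_cases h₁ : α.tgt = β.src <;> by_cases h₂ : β.tgt = γ.src
  · have e₁ : (mulPath γ β : PathAlgebra k V) = ofPath (β.comp γ h₂) := dif_pos h₂
    have e₂ : (mulPath β α : PathAlgebra k V) = ofPath (α.comp β h₁) := dif_pos h₁
    rw [e₁, e₂, ← mul_def, ← mul_def, ofPath_mul_ofPath, ofPath_mul_ofPath]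
    have e₃ : (mulPath (β.comp γ h₂) α : PathAlgebra k V) = ofPath (α.comp (β.comp γ h₂) h₁) :=
      dif_pos h₁
    have e₄ : (mulPath γ (α.comp β h₁) : PathAlgebra k V) = ofPath ((α.comp β h₁).comp γ h₂) :=
      dif_pos h₂
    rw [e₃, e₄, QPath.comp_assoc]
  · have e₁ : (mulPath γ β : PathAlgebra k V) = 0 := dif_neg h₂
    have e₂ : (mulPath β α : PathAlgebra k V) = ofPath (α.comp β h₁) := dif_pos h₁
    have e₄ : (mulPath γ (α.comp β h₁) : PathAlgebra k V) = 0 := dif_neg h₂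
    rw [e₁, e₂, ← mul_def, ← mul_def, ofPath_mul_ofPath, e₄]
    simp [mul_def]
  · have e₁ : (mulPath γ β : PathAlgebra k V) = ofPath (β.comp γ h₂) := dif_pos h₂
    have e₂ : (mulPath β α : PathAlgebra k V) = 0 := dif_neg h₁
    have e₃ : (mulPath (β.comp γ h₂) α : PathAlgebra k V) = 0 := dif_neg h₁
    rw [e₁, e₂, ← mul_def, ← mul_def, ofPath_mul_ofPath, e₃]
    simp [mul_def]
  · have e₁ : (mulPath γ β : PathAlgebra k V) = 0 := dif_neg h₂
    have e₂ : (mulPath β α : PathAlgebra k V) = 0 := dif_neg h₁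
    rw [e₁, e₂]
    simp

theorem induction_path {P : PathAlgebra k V → Prop} (x : PathAlgebra k V) (zero : P 0)
    (add : ∀ x y, P x → P y → P (x + y)) (smul : ∀ (c : k) x, P x → P (c • x))
    (path : ∀ α, P (ofPath α)) : P x := by
  refine Finsupp.induction_linear (motive := P) x zero add fun α c => ?_
  have h : (Finsupp.single α c : QPath V →₀ k) = c • Finsupp.single α (1 : k) := by simp
  rw [h]
  exact smul c _ (path α)

theorem mulHom_assoc (x y z : PathAlgebra k V) :
    mulHom k V (mulHom k V x y) z = mulHom k V x (mulHom k V y z) := by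
  induction x using induction_path with
  | zero => simp
  | add x x' hx hx' => simp [hx, hx']
  | smul c x hx => simp [hx]
  | path γ =>
    induction y using induction_path with
    | zero => simp
    | add x x' hx hx' => simp [hx, hx']
    | smul c x hx => simp [hx]
    | path β =>
      induction z using induction_path with
      | zero => simp
      | add x x' hx hx' => simp [hx, hx']
      | smul c x hx => simp [hx]
      | path α =>
        rw [← mul_def (ofPath γ), ofPath_mul_ofPath, ← mul_def (ofPath β), ofPath_mul_ofPath,
          mulPath_assoc]

theorem one_mulHom [Fintype V] (x : PathAlgebra k V) : mulHom k V 1 x = x := by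
  induction x using induction_path with
  | zero => simp
  | add x x' hx hx' => simp [hx, hx']
  | smul c x hx => simp [hx]
  | path α =>
    rw [one_def, map_sum, LinearMap.sum_apply, Finset.sum_eq_single α.tgt]
    · rw [← mul_def, ofPath_mul_ofPath]
      have e : (mulPath (QPath.nil α.tgt) α : PathAlgebra k V)
          = ofPath (α.comp (QPath.nil α.tgt) rfl) := dif_pos rfl
      rw [e, QPath.comp_nil]
    · intro b _ hb
      rw [← mul_def, ofPath_mul_ofPath]
      exact dif_neg fun h => hb h.symm
    · simp

theorem mulHom_one [Fintype V] (x : PathAlgebra k V) : mulHom k V x 1 = x := by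
  induction x using induction_path with
  | zero => simp
  | add x x' hx hx' => simp [hx, hx']
  | smul c x hx => simp [hx]
  | path α =>
    rw [one_def, map_sum, Finset.sum_eq_single α.src]
    · rw [← mul_def, ofPath_mul_ofPath]
      have e : (mulPath α (QPath.nil α.src) : PathAlgebra k V)
          = ofPath ((QPath.nil α.src).comp α rfl) := dif_pos rfl
      exact e.trans (congrArg ofPath (QPath.nil_comp α α.src rfl))
    · intro b _ hb
      rw [← mul_def, ofPath_mul_ofPath]
      exact dif_neg fun h => hb h
    · simp

instance [Fintype V] : Ring (PathAlgebra k V) where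
  __ := (inferInstance : AddCommGroup (PathAlgebra k V))
  mul := (· * ·)
  one := 1
  left_distrib x y z := by simp [mul_def]
  right_distrib x y z := by simp [mul_def]
  zero_mul x := by simp [mul_def]
  mul_zero x := by simp [mul_def]
  mul_assoc x y z := mulHom_assoc x y z
  one_mul x := one_mulHom x
  mul_one x := mulHom_one x

instance [Fintype V] : Algebra k (PathAlgebra k V) :=
  Algebra.ofModule (fun c x y => by simp [mul_def]) (fun c x y => by simp [mul_def])

end

end PathAlgebra

/-- The monomial algebra `kQ/⟨Z⟩`, where `⟨Z⟩` is the two-sided ideal generated by the paths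
in `Z`. -/
abbrev MonomialAlgebra (k : Type u) {V : Type v} [Quiver.{w} V] [Field k] [Fintype V]
    (Z : Set (QPath V)) : Type max u v w :=
  PathAlgebra k V ⧸
    (TwoSidedIdeal.span ((fun γ : QPath V => (PathAlgebra.ofPath γ : PathAlgebra k V)) '' Z)).asIdeal

/-! ### Hochschild homology in degree one -/

section Hochschild

open TensorProduct

variable (k : Type u) (A : Type v) [Field k] [Ring A] [Algebra k A]

/-- The Hochschild differential `A ⊗ A → A`, `a ⊗ b ↦ ab - ba`. -/
noncomputable def hochschildB₁ : A ⊗[k] A →ₗ[k] A :=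
  LinearMap.mul' k A - LinearMap.mul' k A ∘ₗ (TensorProduct.comm k A A).toLinearMap

/-- The Hochschild differential `A ⊗ A ⊗ A → A ⊗ A`,
`a ⊗ b ⊗ c ↦ ab ⊗ c - a ⊗ bc + ca ⊗ b`. -/
noncomputable def hochschildB₂ : (A ⊗[k] A) ⊗[k] A →ₗ[k] A ⊗[k] A :=
  (LinearMap.mul' k A).rTensor A
    - (LinearMap.mul' k A).lTensor A ∘ₗ (TensorProduct.assoc k A A A).toLinearMap
    + (LinearMap.mul' k A).rTensor A ∘ₗ (TensorProduct.assoc k A A A).symm.toLinearMap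
        ∘ₗ (TensorProduct.comm k (A ⊗[k] A) A).toLinearMap

theorem hochschildB₁_tmul (a b : A) : hochschildB₁ k A (a ⊗ₜ b) = a * b - b * a := by
  simp [hochschildB₁]

theorem hochschildB₂_tmul (a b c : A) :
    hochschildB₂ k A (a ⊗ₜ b ⊗ₜ c) = (a * b) ⊗ₜ c - a ⊗ₜ (b * c) + (c * a) ⊗ₜ b := by
  simp [hochschildB₂]

theorem hochschildB₁_comp_hochschildB₂ : hochschildB₁ k A ∘ₗ hochschildB₂ k A = 0 := by
  ext a b c
  simp [hochschildB₁_tmul, hochschildB₂_tmul, mul_assoc]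

/-- The first Hochschild homology `HH₁(A)`, the homology of the Hochschild complex
`A ⊗ A ⊗ A → A ⊗ A → A` in the middle. -/
abbrev HH₁ : Type _ :=
  LinearMap.ker (hochschildB₁ k A) ⧸
    (LinearMap.range (hochschildB₂ k A)).submoduleOf (LinearMap.ker (hochschildB₁ k A))

end Hochschild

/-! ### Cycles and circuits -/

/-- The cycles of the quiver: paths whose source and target agree, vertices included. -/
abbrev QCycle (V : Type v) [Quiver.{w} V] : Type max v w := Σ a : V, Path a a

section Circuits

variable {V : Type v} [Quiver.{w} V]

/-- A cycle seen as a path. -/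
def QCycle.toQPath (γ : QCycle V) : QPath V := ⟨γ.1, γ.1, γ.2⟩

/-- Rotation of cycles: the last arrow of the cycle is moved to the first place; a vertex is fixed.
This is `γₙ ⋯ γ₁ ↦ γₙ₋₁ ⋯ γ₁ γₙ`, the inverse of the rotation `γₙ ⋯ γ₁ ↦ γ₁ γₙ ⋯ γ₂`; both generate
the same equivalence relation and have the same periods. -/
def QCycle.rotate : QCycle V → QCycle V
  | ⟨a, .nil⟩ => ⟨a, .nil⟩
  | ⟨_, .cons p e⟩ => ⟨_, e.toPath.comp p⟩

theorem QCycle.rotate_cons {a b : V} (p : Path a b) (e : b ⟶ a) :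
    QCycle.rotate ⟨a, p.cons e⟩ = ⟨b, e.toPath.comp p⟩ := rfl

theorem QCycle.iterate_rotate_comp {a b : V} (p : Path a b) (q : Path b a) :
    QCycle.rotate^[q.length] ⟨a, p.comp q⟩ = ⟨b, q.comp p⟩ := by
  suffices H : ∀ {c : V} (q : Path b c) (h : c = a) (p : Path c b),
      QCycle.rotate^[q.length] ⟨c, p.comp q⟩ = ⟨b, q.comp p⟩ from H q rfl p
  intro c q h
  clear h p
  induction q with
  | nil => intro p; simp
  | cons q e ih =>
    intro p
    rw [Path.length_cons, Function.iterate_succ_apply, Path.comp_cons, QCycle.rotate_cons,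
      ← Path.comp_assoc, ih, ← Path.comp_assoc]
    rfl

theorem QCycle.isPeriodicPt_rotate (γ : QCycle V) :
    Function.IsPeriodicPt QCycle.rotate γ.2.length γ := by
  obtain ⟨a, p⟩ := γ
  have h := QCycle.iterate_rotate_comp Path.nil p
  rwa [Path.nil_comp] at h

theorem QCycle.length_rotate (γ : QCycle V) : γ.rotate.2.length = γ.2.length := by
  obtain ⟨a, p⟩ := γ
  cases p with
  | nil => rfl
  | cons p e => simp [QCycle.rotate_cons, Path.length_comp, Nat.add_comm]

theorem QCycle.minimalPeriod_rotate (γ : QCycle V) :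
    Function.minimalPeriod QCycle.rotate γ.rotate = Function.minimalPeriod QCycle.rotate γ := by
  obtain ⟨a, p⟩ := γ
  cases p with
  | nil => rfl
  | cons p e =>
    exact Function.minimalPeriod_apply
      (Function.mk_mem_periodicPts (Nat.succ_pos _) (QCycle.isPeriodicPt_rotate ⟨a, p.cons e⟩))

/-- A circuit is an equivalence class of cycles for the equivalence relation generated by
rotation. -/
def Circuit (V : Type v) [Quiver.{w} V] : Type max v w :=
  Quot fun γ δ : QCycle V => δ = γ.rotate

/-- The circuit of a cycle. -/
def QCycle.circuit (γ : QCycle V) : Circuit V := Quot.mk _ γ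

/-- The common length of the cycles of a circuit. -/
def Circuit.length (C : Circuit V) : ℕ :=
  Quot.lift (fun γ : QCycle V => γ.2.length)
    (fun γ δ h => by subst h; exact (QCycle.length_rotate γ).symm) C

/-- The period of a circuit: the smallest `l ≥ 1` such that the `l`-th rotated of a cycle of the
circuit is the cycle itself. -/
noncomputable def Circuit.period (C : Circuit V) : ℕ :=
  Quot.lift (fun γ : QCycle V => Function.minimalPeriod QCycle.rotate γ)
    (fun γ δ h => by subst h; exact (QCycle.minimalPeriod_rotate γ).symm) C

/-- The multiplicity of a circuit: its length divided by its period (the division is exact). -/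
noncomputable def Circuit.multiplicity (C : Circuit V) : ℕ := C.length / C.period

theorem Circuit.period_dvd_length (C : Circuit V) : C.period ∣ C.length := by
  induction C using Quot.ind with
  | mk γ => exact (QCycle.isPeriodicPt_rotate γ).minimalPeriod_dvd

/-- A circuit is trivial if it is the circuit of a vertex. -/
def Circuit.IsTrivial (C : Circuit V) : Prop :=
  ∃ a : V, C = QCycle.circuit ⟨a, Path.nil⟩

/-! ### Cyclic pairs -/

/-- A pair of paths `(α, β)` with `t(β) = s(α)` and `t(α) = s(β)`. -/
structure CyclicPair (V : Type v) [Quiver.{w} V] where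
  /-- source of the first path, target of the second one -/
  a : V
  /-- target of the first path, source of the second one -/
  b : V
  /-- the first path -/
  fst : Path a b
  /-- the second path -/
  snd : Path b a

/-- The circuit of a cyclic pair `(α, β)`: the class of the cycle `αβ`. -/
def CyclicPair.circuit (x : CyclicPair V) : Circuit V :=
  QCycle.circuit ⟨x.b, x.snd.comp x.fst⟩

/-- `X ⊙ Y`, the set of cyclic pairs with first path in `X` and second path in `Y`. -/
def cyclicPairs (X Y : Set (QPath V)) : Set (CyclicPair V) :=
  {x | (⟨x.a, x.b, x.fst⟩ : QPath V) ∈ X ∧ (⟨x.b, x.a, x.snd⟩ : QPath V) ∈ Y}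

/-- `(X ⊙ Y)_C`, the cyclic pairs in `X ⊙ Y` whose circuit is `C`. -/
def cyclicPairsOn (X Y : Set (QPath V)) (C : Circuit V) : Set (CyclicPair V) :=
  {x | x ∈ cyclicPairs X Y ∧ x.circuit = C}

variable (V) in
/-- `Q₀`, the vertices, seen as the paths of length zero. -/
def vertexPaths : Set (QPath V) := {α | α.length = 0}

variable (V) in
/-- `Q₁`, the arrows, seen as the paths of length one. -/
def arrowPaths : Set (QPath V) := {α | α.length = 1}

/-! ### Combinatorics of a set `Z` of paths -/

/-- `Z` consists of paths of length at least two, and no strict subpath of a path of `Z`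
is in `Z`. -/
def IsMinimalRelations (Z : Set (QPath V)) : Prop :=
  (∀ γ ∈ Z, 2 ≤ γ.length) ∧ ∀ γ ∈ Z, ∀ δ : QPath V, δ.IsSubpath γ → δ ≠ γ → δ ∉ Z

/-- `B`, the paths which do not contain any path of `Z`. -/
def basisPaths (Z : Set (QPath V)) : Set (QPath V) :=
  {γ | ∀ δ ∈ Z, ¬ δ.IsSubpath γ}

/-- A circuit is useful if `(Q₁ ⊙ B)_C` is not empty. -/
def IsUseful (Z : Set (QPath V)) (C : Circuit V) : Prop :=
  (cyclicPairsOn (arrowPaths V) (basisPaths Z) C).Nonempty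

/-- A circuit is strong if each of its cycles is in `B`. -/
def IsStrong (Z : Set (QPath V)) (C : Circuit V) : Prop :=
  ∀ γ : QCycle V, γ.circuit = C → γ.toQPath ∈ basisPaths Z

/-- A circuit is efficient if it is useful, not strong, and `(Z ⊙ B)_C` is not empty. -/
def IsEfficient (Z : Set (QPath V)) (C : Circuit V) : Prop :=
  IsUseful Z C ∧ ¬ IsStrong Z C ∧ (cyclicPairsOn Z (basisPaths Z) C).Nonempty

/-- `W`, the cycles which contain precisely one path of `Z`, located at their end. Occurrences
are counted with their position: some path of `Z` sits at the end of the cycle, and wherever a path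
`ξ` of `Z` occurs in the cycle as `β ξ α`, the path `β` is a vertex. (Two paths of `Z` located at
the end are equal when `Z` is minimal.) -/
def endCycles (Z : Set (QPath V)) : Set (QCycle V) :=
  {γ | (∃ ξ ∈ Z, ∃ (α : Path γ.1 ξ.src) (h : ξ.tgt = γ.1),
          γ.2 = α.comp (ξ.path.cast rfl h)) ∧
    ∀ ξ ∈ Z, ∀ (α : Path γ.1 ξ.src) (β : Path ξ.tgt γ.1),
      γ.2 = (α.comp ξ.path).comp β → β.length = 0}

/-- `W ∩ C`; its cardinality is `w_C`. -/
def endCyclesOn (Z : Set (QPath V)) (C : Circuit V) : Set (QCycle V) :=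
  {γ | γ ∈ endCycles Z ∧ γ.circuit = C}

/-- The set of efficient circuits. -/
def efficientCircuits (Z : Set (QPath V)) : Set (Circuit V) := {C | IsEfficient Z C}

/-- The set of efficient `p'`-circuits: the multiplicity is not divisible by `p`. -/
def efficientPrimeCircuits (p : ℕ) (Z : Set (QPath V)) : Set (Circuit V) :=
  {C | IsEfficient Z C ∧ ¬ p ∣ C.multiplicity}

/-- The set of non trivial strong circuits. -/
def strongCircuits (Z : Set (QPath V)) : Set (Circuit V) :=
  {C | IsStrong Z C ∧ ¬ C.IsTrivial}

/-- A circuit has only finitely many cycles, so that `w_C` is always a natural number. -/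
theorem finite_circuit (C : Circuit V) : {γ : QCycle V | γ.circuit = C}.Finite := by
  induction C using Quot.ind with
  | mk γ₀ =>
    have hper : ∀ γ : QCycle V, ∃ n, QCycle.rotate^[n + 1] γ = γ := by
      rintro ⟨a, p⟩
      cases p with
      | nil => exact ⟨0, rfl⟩
      | cons p e => exact ⟨p.length, QCycle.isPeriodicPt_rotate ⟨a, p.cons e⟩⟩
    have hstep : ∀ γ : QCycle V, (∃ i, QCycle.rotate^[i] γ₀ = γ) ↔
        ∃ i, QCycle.rotate^[i] γ₀ = γ.rotate := by
      intro γ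
      constructor
      · rintro ⟨i, rfl⟩
        exact ⟨i + 1, Function.iterate_succ_apply' _ _ _⟩
      · rintro ⟨i, hi⟩
        obtain ⟨n, hn⟩ := hper γ
        refine ⟨n + i, ?_⟩
        rw [Function.iterate_add_apply, hi, ← Function.iterate_succ_apply, hn]
    obtain ⟨n, hn⟩ := hper γ₀
    refine (Set.finite_range fun i : Fin (n + 1) => QCycle.rotate^[i.1] γ₀).subset ?_
    intro γ hγ
    have hlift : (∃ i, QCycle.rotate^[i] γ₀ = γ) = ∃ i, QCycle.rotate^[i] γ₀ = γ₀ :=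
      congrArg (Quot.lift (fun γ : QCycle V => ∃ i, QCycle.rotate^[i] γ₀ = γ)
        (fun γ δ h => by subst h; exact propext (hstep γ))) hγ
    obtain ⟨i, hi⟩ := hlift.mpr ⟨0, rfl⟩
    refine ⟨⟨i % (n + 1), Nat.mod_lt _ n.succ_pos⟩, ?_⟩
    have hn' : Function.IsPeriodicPt QCycle.rotate (n + 1) γ₀ := hn
    simpa [hi] using hn'.iterate_mod_apply i

end Circuits

end HochMon

open HochMon

/-!
The first Hochschild homology of a monomial algebra `A` is the homology in the middle of the small
complex `k (Z ⊙ B) → k (Q₁ ⊙ B) → k (Q₀ ⊙ B)`, which splits over the circuits. A pair `(a, q)` of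
`Q₁ ⊙ B` is the same as the cycle `a q`, and in these terms everything is governed by rotation `ρ`
of cycles: the last differential is `γ ↦ ρ γ - γ`, with cycles outside of `B` read as zero, and
the boundaries are the sums of all the rotations of the cycles which are not in `B`.

That this complex computes `HH₁` is shown directly. Modulo the image of `A ⊗ A ⊗ A`, the tensor
`α ⊗ β` behaves as the form `α dβ` modulo commutators, and the Leibniz rule expands it along the
arrows of `β`, that is, into a sum over the first `|β|` rotations of the cycle formed by `α` and `β`
(`MonomialModel.mkQ_toTensor_arrowSum`). The same formula defines a map in the other direction
(`MonomialModel.ofTensor`). Pairs `α`, `β` which do not form a cycle give forms which are determined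
by their Hochschild differential (`MonomialModel.toTensorQuot_ofTensor_add`), so they do not
contribute to the homology.

It remains to count. A combination of pairs is killed by the differential when its coefficients agree
at `γ` and at the previous rotation of `γ`, for each cycle `γ` in `B`. Going backwards from a cycle
`a q` through cycles of `B`, one either stops at a cycle of `W` or stays forever in a strong circuit;
so the kernel has dimension `s + |W|` (`MonomialModel.rank_ker_arrowDifferential`). The sum of the
rotations of a cycle of the circuit `C` is the multiplicity of `C` times the sum of `(Q₁ ⊙ B)_C`, so
the boundaries have dimension `e_{p'}` (`rank_normSpan`). Finally, useful circuits which are not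
strong are efficient, so that `W` is the disjoint union of the `W ∩ C` with `C` efficient, and `W` is
the complement in `Q₁ ⊙ B` of the cycles of positive length in `B`, which together with the vertices
make up `Q₀ ⊙ B`.
-/

namespace HochMon

open Quiver

/-! ### Rotation of cycles -/

section Rotation

variable {V : Type v} [Quiver.{w} V]

theorem QCycle.exists_iterate_rotate_eq_self (γ : QCycle V) :
    ∃ n, QCycle.rotate^[n + 1] γ = γ := by
  obtain ⟨a, p⟩ := γ
  cases p with
  | nil => exact ⟨0, rfl⟩
  | cons p e => exact ⟨p.length, QCycle.isPeriodicPt_rotate ⟨a, p.cons e⟩⟩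

theorem QCycle.mem_periodicPts_rotate (γ : QCycle V) :
    γ ∈ Function.periodicPts (QCycle.rotate (V := V)) := by
  obtain ⟨n, hn⟩ := γ.exists_iterate_rotate_eq_self
  exact Function.mk_mem_periodicPts n.succ_pos hn

theorem QCycle.rotate_bijective : Function.Bijective (QCycle.rotate (V := V)) := by
  constructor
  · intro γ δ h
    obtain ⟨m, hm⟩ := γ.exists_iterate_rotate_eq_self
    obtain ⟨n, hn⟩ := δ.exists_iterate_rotate_eq_self
    have hγ : Function.IsPeriodicPt QCycle.rotate ((m + 1) * (n + 1)) γ :=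
      Function.IsPeriodicPt.mul_const hm _
    have hδ : Function.IsPeriodicPt QCycle.rotate ((m + 1) * (n + 1)) δ :=
      Function.IsPeriodicPt.const_mul hn _
    have e : (m + 1) * (n + 1) = (m * n + m + n) + 1 := by ring
    rw [e] at hγ hδ
    rw [← hγ.eq, ← hδ.eq, Function.iterate_succ_apply, Function.iterate_succ_apply, h]
  · intro γ
    obtain ⟨n, hn⟩ := γ.exists_iterate_rotate_eq_self
    exact ⟨_, (Function.iterate_succ_apply' _ _ _).symm.trans hn⟩

/-- Rotation as a permutation of the set of cycles. -/
noncomputable def QCycle.rotateEquiv : Equiv.Perm (QCycle V) :=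
  Equiv.ofBijective QCycle.rotate QCycle.rotate_bijective

theorem QCycle.rotateEquiv_apply (γ : QCycle V) : QCycle.rotateEquiv γ = γ.rotate := rfl

theorem QCycle.circuit_rotate (γ : QCycle V) : γ.rotate.circuit = γ.circuit :=
  (Quot.sound (r := fun γ δ : QCycle V => δ = γ.rotate) rfl).symm

theorem QCycle.circuit_iterate_rotate (n : ℕ) (γ : QCycle V) :
    (QCycle.rotate^[n] γ).circuit = γ.circuit := by
  induction n with
  | zero => rfl
  | succ n ih => rw [Function.iterate_succ_apply', QCycle.circuit_rotate, ih]

theorem QCycle.circuit_eq_iff {γ δ : QCycle V} :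
    γ.circuit = δ.circuit ↔ ∃ i, QCycle.rotate^[i] γ = δ := by
  constructor
  · intro h
    have hstep : ∀ δ : QCycle V, (∃ i, QCycle.rotate^[i] γ = δ) ↔
        ∃ i, QCycle.rotate^[i] γ = δ.rotate := by
      intro δ
      constructor
      · rintro ⟨i, rfl⟩
        exact ⟨i + 1, Function.iterate_succ_apply' _ _ _⟩
      · rintro ⟨i, hi⟩
        obtain ⟨n, hn⟩ := δ.exists_iterate_rotate_eq_self
        refine ⟨n + i, ?_⟩
        rw [Function.iterate_add_apply, hi, ← Function.iterate_succ_apply, hn]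
    have hlift : (∃ i, QCycle.rotate^[i] γ = γ) = ∃ i, QCycle.rotate^[i] γ = δ :=
      congrArg (Quot.lift (fun δ : QCycle V => ∃ i, QCycle.rotate^[i] γ = δ)
        (fun γ δ h => by subst h; exact propext (hstep γ))) h
    exact hlift.mp ⟨0, rfl⟩
  · rintro ⟨i, rfl⟩
    exact (QCycle.circuit_iterate_rotate i γ).symm

theorem Circuit.isTrivial_circuit_iff {γ : QCycle V} :
    γ.circuit.IsTrivial ↔ γ.2.length = 0 := by
  constructor
  · rintro ⟨a, h⟩
    exact congrArg Circuit.length h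
  · obtain ⟨a, p⟩ := γ
    intro h
    exact ⟨a, by rw [Path.eq_nil_of_length_zero p h]⟩

theorem QCycle.exists_iterate_symm_rotateEquiv {γ δ : QCycle V} (h : γ.circuit = δ.circuit) :
    ∃ i, QCycle.rotateEquiv.symm^[i] γ = δ := by
  obtain ⟨i, rfl⟩ := QCycle.circuit_eq_iff.1 h.symm
  exact ⟨i, (Function.LeftInverse.iterate QCycle.rotateEquiv.symm_apply_apply i) δ⟩

theorem QCycle.circuit_symm_rotateEquiv (γ : QCycle V) :
    (QCycle.rotateEquiv.symm γ).circuit = γ.circuit := by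
  conv_rhs => rw [← QCycle.rotateEquiv.apply_symm_apply γ]
  exact (QCycle.circuit_rotate _).symm

/-- In a window of `γ.2.length` consecutive rotations of `γ`, each cycle of the circuit of `γ` is met
as many times as the multiplicity of the circuit. -/
theorem QCycle.count_iterate_rotate [DecidableEq (QCycle V)] {γ δ : QCycle V}
    (h : γ.circuit = δ.circuit) :
    Nat.count (fun i => QCycle.rotate^[i] γ = δ) γ.2.length = γ.circuit.multiplicity := by
  obtain ⟨j, rfl⟩ := QCycle.circuit_eq_iff.1 h
  have hmem := γ.mem_periodicPts_rotate
  have hpos := Function.minimalPeriod_pos_of_mem_periodicPts hmem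
  have hdvd := (QCycle.isPeriodicPt_rotate γ).minimalPeriod_dvd
  have hiff : ∀ i, QCycle.rotate^[i] γ = QCycle.rotate^[j] γ ↔
      i ≡ j [MOD Function.minimalPeriod QCycle.rotate γ] := by
    intro i
    rw [← Function.iterate_mod_minimalPeriod_eq (n := i),
      ← Function.iterate_mod_minimalPeriod_eq (n := j),
      Function.iterate_eq_iterate_iff_of_lt_minimalPeriod (Nat.mod_lt _ hpos) (Nat.mod_lt _ hpos)]
    rfl
  simp only [hiff]
  rw [Nat.count_modEq_card _ hpos, Nat.mod_eq_zero_of_dvd hdvd]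
  simp only [not_lt_zero, if_false, add_zero]
  rfl

end Rotation

/-! ### Basis paths and the cycles attached to them -/

section Basis

variable {V : Type v} [Quiver.{w} V] {Z : Set (QPath V)}

theorem mem_basisPaths_of_comp_left {a b c : V} {p : Path a b} {q : Path b c}
    (h : (⟨a, c, p.comp q⟩ : QPath V) ∈ basisPaths Z) : (⟨a, b, p⟩ : QPath V) ∈ basisPaths Z := by
  rintro δ hδ ⟨α, β, e⟩
  dsimp only at α β e
  exact h δ hδ ⟨α, β.comp q, by simp [e, Path.comp_assoc]⟩

theorem mem_basisPaths_of_comp_right {a b c : V} {p : Path a b} {q : Path b c}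
    (h : (⟨a, c, p.comp q⟩ : QPath V) ∈ basisPaths Z) : (⟨b, c, q⟩ : QPath V) ∈ basisPaths Z := by
  rintro δ hδ ⟨α, β, e⟩
  dsimp only at α β e
  exact h δ hδ ⟨p.comp α, β, by simp [e, Path.comp_assoc]⟩

theorem nil_mem_basisPaths (hZ : IsMinimalRelations Z) (a : V) :
    (⟨a, a, Path.nil⟩ : QPath V) ∈ basisPaths Z := by
  rintro δ hδ ⟨α, β, e⟩
  have h := congrArg Path.length e
  have h2 := hZ.1 δ hδ
  simp only [Path.length_comp, Path.length_nil, QPath.length] at h h2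
  omega

variable (Z) in
/-- The cycles `a q` with `a` an arrow and `q` in `B`. Such a cycle determines the pair `(a, q)`, so
this set is a model of `Q₁ ⊙ B`. -/
def arrowCycles : Set (QCycle V) :=
  {γ | ∃ (b : V) (q : Path γ.1 b) (e : b ⟶ γ.1),
    γ.2 = q.cons e ∧ (⟨γ.1, b, q⟩ : QPath V) ∈ basisPaths Z}

variable (Z) in
/-- The cycles of positive length which are in `B`. -/
def basisCycles : Set (QCycle V) := {γ | γ.toQPath ∈ basisPaths Z ∧ 0 < γ.2.length}

theorem mk_cons_mem_arrowCycles {a b : V} {q : Path a b} {e : b ⟶ a} :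
    (⟨a, q.cons e⟩ : QCycle V) ∈ arrowCycles Z ↔ (⟨a, b, q⟩ : QPath V) ∈ basisPaths Z := by
  constructor
  · rintro ⟨b', q', e', h, hq⟩
    dsimp only at q' e' h hq
    cases h
    exact hq
  · intro h
    exact ⟨b, q, e, rfl, h⟩

theorem mk_nil_notMem_arrowCycles (a : V) : (⟨a, Path.nil⟩ : QCycle V) ∉ arrowCycles Z := by
  rintro ⟨b', q', e', h, hq⟩
  exact Path.nil_ne_cons _ _ h

theorem arrowCycles.length_pos {γ : QCycle V} (h : γ ∈ arrowCycles Z) : 0 < γ.2.length := by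
  obtain ⟨b, q, e, h, -⟩ := h
  rw [h, Path.length_cons]
  exact Nat.succ_pos _

theorem basisCycles_subset_arrowCycles : basisCycles Z ⊆ arrowCycles Z := by
  rintro ⟨a, p⟩ ⟨h, hl⟩
  cases p with
  | nil => exact absurd hl (lt_irrefl _)
  | cons p e =>
    rw [mk_cons_mem_arrowCycles]
    exact mem_basisPaths_of_comp_left (q := e.toPath) h

theorem mem_arrowCycles_of_rotate_mem {γ : QCycle V} (h : γ.rotate ∈ basisCycles Z) :
    γ ∈ arrowCycles Z := by
  obtain ⟨a, p⟩ := γ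
  cases p with
  | nil => exact absurd h.2 (lt_irrefl _)
  | cons p e =>
    rw [mk_cons_mem_arrowCycles]
    exact mem_basisPaths_of_comp_right (p := e.toPath) h.1

theorem symm_rotateEquiv_mem_arrowCycles {γ : QCycle V} (h : γ ∈ basisCycles Z) :
    QCycle.rotateEquiv.symm γ ∈ arrowCycles Z := by
  apply mem_arrowCycles_of_rotate_mem
  rw [← QCycle.rotateEquiv_apply, Equiv.apply_symm_apply]
  exact h

/-- In a cycle `a q` with `a` an arrow and `q` in `B`, the paths of `Z` can only occur at the end. -/
theorem length_eq_zero_of_eq_comp {a b : V} {q : Path a b} {e : b ⟶ a}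
    (hq : (⟨a, b, q⟩ : QPath V) ∈ basisPaths Z) {ξ : QPath V} (hξ : ξ ∈ Z)
    {α : Path a ξ.src} {β : Path ξ.tgt a} (h : q.cons e = (α.comp ξ.path).comp β) :
    β.length = 0 := by
  obtain ⟨s, t, z⟩ := ξ
  dsimp only at α β h
  cases β with
  | nil => rfl
  | cons β f =>
    rw [Path.comp_cons] at h
    cases h
    exact absurd ⟨α, β, rfl⟩ (hq _ hξ)

/-- `W` consists of the cycles `a q` outside of `B` with `a` an arrow and `q` in `B`. -/
theorem endCycles_eq (hZ : IsMinimalRelations Z) :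
    endCycles Z = arrowCycles Z \ basisCycles Z := by
  ext ⟨a, p⟩
  constructor
  · rintro ⟨⟨⟨s, t, z⟩, hξ, α, h, e⟩, hend⟩
    dsimp only at α h e hend
    subst h
    have h2 := hZ.1 _ hξ
    replace e : p = α.comp z := e
    refine ⟨?_, fun h => h.1 _ hξ ⟨α, Path.nil, by simp [QCycle.toQPath, e]⟩⟩
    cases p with
    | nil =>
      have h := congrArg Path.length e
      simp only [Path.length_comp, Path.length_nil, QPath.length] at h h2
      omega
    | cons p f =>
      rw [mk_cons_mem_arrowCycles]
      rintro δ hδ ⟨α', β', e'⟩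
      dsimp only at α' β' e'
      have := hend δ hδ α' (β'.cons f) (by rw [e', Path.comp_cons])
      simp at this
  · rintro ⟨hS, hT⟩
    cases p with
    | nil => exact absurd hS (mk_nil_notMem_arrowCycles a)
    | cons q e =>
      rw [mk_cons_mem_arrowCycles] at hS
      refine ⟨?_, fun ξ hξ α β h => length_eq_zero_of_eq_comp hS hξ h⟩
      have : (⟨a, a, q.cons e⟩ : QPath V) ∉ basisPaths Z := fun h => hT ⟨h, Nat.succ_pos _⟩
      simp only [basisPaths, Set.mem_ofPred_eq, not_forall, not_not] at this
      obtain ⟨ξ, hξ, α, β, h⟩ := this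
      dsimp only at α β h
      have hβ := length_eq_zero_of_eq_comp hS hξ h
      obtain ⟨s, t, z⟩ := ξ
      dsimp only at α β h
      obtain rfl := Path.eq_of_length_zero β hβ
      obtain rfl := Path.eq_nil_of_length_zero β hβ
      exact ⟨_, hξ, α, rfl, by simpa using h⟩

theorem isUseful_iff {C : Circuit V} :
    IsUseful Z C ↔ ∃ γ ∈ arrowCycles Z, γ.circuit = C := by
  constructor
  · rintro ⟨⟨a, b, f, q⟩, ⟨hf, hq⟩, hC⟩
    refine ⟨_, ?_, hC⟩
    cases f with
    | nil => exact absurd hf (by simp [arrowPaths, QPath.length])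
    | cons f e =>
      have : f.length = 0 := by simpa [arrowPaths, QPath.length] using hf
      obtain rfl := Path.eq_of_length_zero f this
      obtain rfl := Path.eq_nil_of_length_zero f this
      exact mk_cons_mem_arrowCycles.2 hq
  · rintro ⟨⟨a, p⟩, hγ, hC⟩
    cases p with
    | nil => exact absurd hγ (mk_nil_notMem_arrowCycles a)
    | cons q e =>
      exact ⟨⟨_, _, e.toPath, q⟩, ⟨rfl, mk_cons_mem_arrowCycles.1 hγ⟩, hC⟩

/-- Going backwards along a non strong circuit from one of its cycles `a q` with `q` in `B`, the
first cycle outside of `B` belongs to `W`. -/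
theorem exists_mem_diff_of_useful {C : Circuit V} (hC : ¬ IsStrong Z C)
    {γ : QCycle V} (hγ : γ ∈ arrowCycles Z) (hγC : γ.circuit = C) :
    ∃ δ ∈ arrowCycles Z \ basisCycles Z, δ.circuit = C := by
  classical
  simp only [IsStrong, not_forall] at hC
  obtain ⟨δ, hδ, hδB⟩ := hC
  obtain ⟨j, hj⟩ := QCycle.exists_iterate_symm_rotateEquiv (hγC.trans hδ.symm)
  have hex : ∃ i, QCycle.rotateEquiv.symm^[i] γ ∉ basisCycles Z :=
    ⟨j, fun h => hδB (hj ▸ h).1⟩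
  refine ⟨_, ⟨?_, Nat.find_spec hex⟩, ?_⟩
  · rcases h : Nat.find hex with _ | i
    · exact hγ
    · rw [Function.iterate_succ_apply']
      apply symm_rotateEquiv_mem_arrowCycles
      by_contra hn
      exact Nat.find_min hex (by omega) hn
  · rw [← hγC]
    generalize Nat.find hex = i
    induction i with
    | zero => rfl
    | succ i ih => rw [Function.iterate_succ_apply', QCycle.circuit_symm_rotateEquiv, ih]

/-- The circuit of a cycle of `W` is efficient. -/
theorem isEfficient_of_mem_diff (hZ : IsMinimalRelations Z) {γ : QCycle V}
    (hγ : γ ∈ arrowCycles Z \ basisCycles Z) : IsEfficient Z γ.circuit := by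
  refine ⟨isUseful_iff.2 ⟨γ, hγ.1, rfl⟩,
    fun h => hγ.2 ⟨h γ rfl, arrowCycles.length_pos hγ.1⟩, ?_⟩
  have hend := (endCycles_eq hZ).symm ▸ hγ
  obtain ⟨a, p⟩ := γ
  obtain ⟨⟨⟨s, t, z⟩, hξ, α, h, e⟩, -⟩ := hend
  dsimp only at α h e
  subst h
  replace e : p = α.comp z := e
  have h2 := hZ.1 _ hξ
  refine ⟨⟨s, t, z, α⟩, ⟨hξ, ?_⟩, by rw [CyclicPair.circuit, e]⟩
  subst e
  cases z with
  | nil => exact absurd h2 (by simp [QPath.length])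
  | cons z f => exact mem_basisPaths_of_comp_left (mk_cons_mem_arrowCycles.1 hγ.1)

/-- Each useful circuit which is not strong is efficient. -/
theorem isEfficient_iff (hZ : IsMinimalRelations Z) {C : Circuit V} :
    IsEfficient Z C ↔ ¬ IsStrong Z C ∧ ∃ γ ∈ arrowCycles Z, γ.circuit = C := by
  refine ⟨fun h => ⟨h.2.1, isUseful_iff.1 h.1⟩, ?_⟩
  rintro ⟨hC, γ, hγ, rfl⟩
  obtain ⟨δ, hδ, e⟩ := exists_mem_diff_of_useful hC hγ rfl
  exact e ▸ isEfficient_of_mem_diff hZ hδ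

/-- `Q₁ ⊙ B` is in bijection with the cycles `a q` with `a` an arrow and `q` in `B`. -/
noncomputable def arrowPairsEquiv : cyclicPairs (arrowPaths V) (basisPaths Z) ≃ arrowCycles Z :=
  Equiv.ofBijective (fun x => ⟨⟨x.1.b, x.1.snd.comp x.1.fst⟩, by
    obtain ⟨⟨a, b, f, q⟩, hf, hq⟩ := x
    cases f with
    | nil => exact absurd hf (by simp [arrowPaths, QPath.length])
    | cons f e =>
      have : f.length = 0 := by simpa [arrowPaths, QPath.length] using hf
      obtain rfl := Path.eq_of_length_zero f this
      obtain rfl := Path.eq_nil_of_length_zero f this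
      exact mk_cons_mem_arrowCycles.2 hq⟩) <| by
    constructor
    · rintro ⟨⟨a, b, f, q⟩, hf, hq⟩ ⟨⟨a', b', f', q'⟩, hf', hq'⟩ h
      cases f with
      | nil => exact absurd hf (by simp [arrowPaths, QPath.length])
      | cons f e =>
        have : f.length = 0 := by simpa [arrowPaths, QPath.length] using hf
        obtain rfl := Path.eq_of_length_zero f this
        obtain rfl := Path.eq_nil_of_length_zero f this
        cases f' with
        | nil => exact absurd hf' (by simp [arrowPaths, QPath.length])
        | cons f' e' =>
          have : f'.length = 0 := by simpa [arrowPaths, QPath.length] using hf'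
          obtain rfl := Path.eq_of_length_zero f' this
          obtain rfl := Path.eq_nil_of_length_zero f' this
          have h := congrArg Subtype.val h
          simp only [Path.comp_cons, Path.comp_nil] at h
          cases h
          rfl
    · rintro ⟨⟨a, p⟩, hγ⟩
      cases p with
      | nil => exact absurd hγ (mk_nil_notMem_arrowCycles a)
      | cons q e => exact ⟨⟨⟨_, _, e.toPath, q⟩, rfl, mk_cons_mem_arrowCycles.1 hγ⟩, rfl⟩

/-- `Q₀ ⊙ B` is in bijection with the disjoint union of the vertices and of the cycles of positive
length in `B`. -/
noncomputable def vertexPairsEquiv (hZ : IsMinimalRelations Z) :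
    V ⊕ basisCycles Z ≃ cyclicPairs (vertexPaths V) (basisPaths Z) :=
  Equiv.ofBijective (Sum.elim
      (fun a => ⟨⟨a, a, Path.nil, Path.nil⟩, rfl, nil_mem_basisPaths hZ a⟩)
      (fun γ => ⟨⟨γ.1.1, γ.1.1, Path.nil, γ.1.2⟩, rfl, γ.2.1⟩)) <| by
    constructor
    · rintro (a | ⟨⟨a, p⟩, hp⟩) (b | ⟨⟨b, q⟩, hq⟩) h
      · have h := congrArg (CyclicPair.a ∘ Subtype.val) h
        exact congrArg Sum.inl h
      · have h : 0 = q.length :=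
          congrArg (fun x : cyclicPairs (vertexPaths V) (basisPaths Z) => x.1.snd.length) h
        exact absurd h hq.2.ne
      · have h : p.length = 0 :=
          congrArg (fun x : cyclicPairs (vertexPaths V) (basisPaths Z) => x.1.snd.length) h
        exact absurd h hp.2.ne'
      · cases h
        rfl
    · rintro ⟨⟨a, b, f, q⟩, hf, hq⟩
      have : f.length = 0 := hf
      obtain rfl := Path.eq_of_length_zero f this
      obtain rfl := Path.eq_nil_of_length_zero f this
      rcases Nat.eq_zero_or_pos q.length with h0 | h0
      · obtain rfl := Path.eq_nil_of_length_zero q h0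
        exact ⟨Sum.inl a, rfl⟩
      · exact ⟨Sum.inr ⟨⟨a, q⟩, hq, h0⟩, rfl⟩

end Basis

/-! ### The paths of `B` as a basis of the monomial algebra -/

section Algebra

variable {k : Type u} [Field k] {V : Type v} [Quiver.{w} V]

namespace PathAlgebra

theorem ofPath_mul_ofPath_mk {a b c : V} (p : Path a b) (q : Path b c) :
    (ofPath ⟨b, c, q⟩ * ofPath ⟨a, b, p⟩ : PathAlgebra k V) = ofPath ⟨a, c, p.comp q⟩ := by
  rw [ofPath_mul_ofPath]
  exact dif_pos rfl

theorem ofPath_mul_ofPath_of_ne {α β : QPath V} (h : α.tgt ≠ β.src) :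
    (ofPath β * ofPath α : PathAlgebra k V) = 0 := by
  rw [ofPath_mul_ofPath]
  exact dif_neg h

end PathAlgebra

open PathAlgebra

variable [Fintype V]

variable (k) in
/-- The span of the paths which contain a path of `Z`. -/
noncomputable def nonBasisSpan (Z : Set (QPath V)) : Submodule k (PathAlgebra k V) :=
  Submodule.span k (ofPath '' (basisPaths Z)ᶜ)

variable {Z : Set (QPath V)}

theorem mul_mem_nonBasisSpan (x : PathAlgebra k V) {y : PathAlgebra k V}
    (hy : y ∈ nonBasisSpan k Z) : x * y ∈ nonBasisSpan k Z := by
  induction x using PathAlgebra.induction_path with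
  | zero => simp
  | add x x' hx hx' => rw [add_mul]; exact add_mem hx hx'
  | smul c x hx => rw [smul_mul_assoc]; exact Submodule.smul_mem _ _ hx
  | path β =>
    induction hy using Submodule.span_induction with
    | zero => simp
    | add y y' _ _ hy hy' => rw [mul_add]; exact add_mem hy hy'
    | smul c y _ hy => rw [mul_smul_comm]; exact Submodule.smul_mem _ _ hy
    | mem y hy =>
      obtain ⟨α, hα, rfl⟩ := hy
      by_cases h : α.tgt = β.src
      · obtain ⟨a, b, p⟩ := α
        obtain ⟨b', c, q⟩ := β
        dsimp only at h
        subst h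
        rw [ofPath_mul_ofPath_mk]
        exact Submodule.subset_span ⟨_, fun h => hα (mem_basisPaths_of_comp_left h), rfl⟩
      · rw [ofPath_mul_ofPath_of_ne h]
        exact zero_mem _

theorem nonBasisSpan_mul_mem (x : PathAlgebra k V) {y : PathAlgebra k V}
    (hy : y ∈ nonBasisSpan k Z) : y * x ∈ nonBasisSpan k Z := by
  induction x using PathAlgebra.induction_path with
  | zero => simp
  | add x x' hx hx' => rw [mul_add]; exact add_mem hx hx'
  | smul c x hx => rw [mul_smul_comm]; exact Submodule.smul_mem _ _ hx
  | path α =>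
    induction hy using Submodule.span_induction with
    | zero => simp
    | add y y' _ _ hy hy' => rw [add_mul]; exact add_mem hy hy'
    | smul c y _ hy => rw [smul_mul_assoc]; exact Submodule.smul_mem _ _ hy
    | mem y hy =>
      obtain ⟨β, hβ, rfl⟩ := hy
      by_cases h : α.tgt = β.src
      · obtain ⟨a, b, p⟩ := α
        obtain ⟨b', c, q⟩ := β
        dsimp only at h
        subst h
        rw [ofPath_mul_ofPath_mk]
        exact Submodule.subset_span ⟨_, fun h => hβ (mem_basisPaths_of_comp_right h), rfl⟩
      · rw [ofPath_mul_ofPath_of_ne h]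
        exact zero_mem _

variable (k Z) in
/-- The ideal of relations of the monomial algebra. -/
noncomputable abbrev relationIdeal : Ideal (PathAlgebra k V) :=
  (TwoSidedIdeal.span
    ((fun γ : QPath V => (PathAlgebra.ofPath γ : PathAlgebra k V)) '' Z)).asIdeal

theorem ofPath_mem_relationIdeal {γ : QPath V} (hγ : γ ∉ basisPaths Z) :
    (ofPath γ : PathAlgebra k V) ∈ relationIdeal k Z := by
  simp only [basisPaths, Set.mem_ofPred_eq, not_forall, not_not] at hγ
  obtain ⟨⟨s, t, z⟩, hξ, α, β, h⟩ := hγ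
  obtain ⟨a, b, p⟩ := γ
  dsimp only at α β h
  subst h
  rw [TwoSidedIdeal.mem_asIdeal, ← ofPath_mul_ofPath_mk, ← ofPath_mul_ofPath_mk]
  exact TwoSidedIdeal.mul_mem_left _ _ _
    (TwoSidedIdeal.mul_mem_right _ _ _ (TwoSidedIdeal.subset_span ⟨_, hξ, rfl⟩))

/-- The ideal generated by `Z` is spanned, as a vector space, by the paths outside of `B`. -/
theorem mem_relationIdeal_iff {x : PathAlgebra k V} :
    x ∈ relationIdeal k Z ↔ x ∈ nonBasisSpan k Z := by
  constructor
  · intro hx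
    let J : TwoSidedIdeal (PathAlgebra k V) := TwoSidedIdeal.mk' (nonBasisSpan k Z)
      (zero_mem _) add_mem neg_mem (mul_mem_nonBasisSpan _) (nonBasisSpan_mul_mem _)
    have hJ : TwoSidedIdeal.span
        ((fun γ : QPath V => (PathAlgebra.ofPath γ : PathAlgebra k V)) '' Z) ≤ J := by
      rw [TwoSidedIdeal.span_le]
      rintro _ ⟨γ, hγ, rfl⟩
      refine (TwoSidedIdeal.mem_mk' _ _ _ _ _ _ _).2 (Submodule.subset_span ⟨γ, fun h => ?_, rfl⟩)
      exact h γ hγ ⟨Path.nil, Path.nil, by simp⟩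
    exact (TwoSidedIdeal.mem_mk' _ _ _ _ _ _ _).1 (hJ (TwoSidedIdeal.mem_asIdeal.1 hx))
  · intro hx
    have : nonBasisSpan k Z ≤ (relationIdeal k Z).restrictScalars k := by
      rw [nonBasisSpan, Submodule.span_le]
      rintro _ ⟨γ, hγ, rfl⟩
      exact ofPath_mem_relationIdeal hγ
    exact this hx

namespace MonomialAlgebra

variable (k Z) in
/-- The image of a path in the monomial algebra. -/
noncomputable def ofPath {a b : V} (p : Path a b) : MonomialAlgebra k Z :=
  Ideal.Quotient.mk (relationIdeal k Z) (PathAlgebra.ofPath ⟨a, b, p⟩)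

theorem ofPath_mul {a b c : V} (p : Path a b) (q : Path b c) :
    ofPath k Z q * ofPath k Z p = ofPath k Z (p.comp q) := by
  rw [ofPath, ofPath, ← map_mul, ofPath_mul_ofPath_mk, ofPath]

theorem ofPath_mul_of_ne {a b b' c : V} (p : Path a b) (q : Path b' c) (h : b ≠ b') :
    ofPath k Z q * ofPath k Z p = 0 := by
  rw [ofPath, ofPath, ← map_mul, ofPath_mul_ofPath_of_ne h, map_zero]

theorem ofPath_eq_zero {a b : V} {p : Path a b} (h : (⟨a, b, p⟩ : QPath V) ∉ basisPaths Z) :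
    ofPath k Z p = 0 :=
  Ideal.Quotient.eq_zero_iff_mem.2 (ofPath_mem_relationIdeal h)

theorem linearIndependent_ofPath :
    LinearIndependent k fun α : basisPaths Z => ofPath k Z α.1.path := by
  have h : LinearIndependent k fun α : QPath V => (PathAlgebra.ofPath α : PathAlgebra k V) :=
    (PathAlgebra.basis k V).linearIndependent
  refine (h.comp (Subtype.val : basisPaths Z → QPath V) Subtype.val_injective).map
    (f := (Ideal.Quotient.mkₐ k (relationIdeal k Z)).toLinearMap) ?_
  have hker : LinearMap.ker (Ideal.Quotient.mkₐ k (relationIdeal k Z)).toLinearMap =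
      nonBasisSpan k Z := by
    ext x
    rw [← mem_relationIdeal_iff]
    exact Ideal.Quotient.eq_zero_iff_mem
  rw [hker, Set.range_comp, Subtype.range_coe]
  exact h.disjoint_span_image disjoint_compl_right

theorem span_ofPath :
    ⊤ ≤ Submodule.span k (Set.range fun α : basisPaths Z => ofPath k Z α.1.path) := by
  rintro x -
  obtain ⟨x, rfl⟩ := (Ideal.Quotient.mkₐ_surjective k (relationIdeal k Z)) x
  induction x using PathAlgebra.induction_path with
  | zero => rw [map_zero]; exact zero_mem _
  | add x x' hx hx' => rw [map_add]; exact add_mem hx hx'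
  | smul c x hx => rw [map_smul]; exact Submodule.smul_mem _ _ hx
  | path α =>
    by_cases h : α ∈ basisPaths Z
    · exact Submodule.subset_span ⟨⟨α, h⟩, rfl⟩
    · have : Ideal.Quotient.mkₐ k (relationIdeal k Z) (PathAlgebra.ofPath α) = 0 :=
        Ideal.Quotient.eq_zero_iff_mem.2 (ofPath_mem_relationIdeal h)
      rw [this]
      exact zero_mem _

end MonomialAlgebra

end Algebra

/-- A model of the monomial algebra of `Z`: an algebra with a basis indexed by `B`, whose product is
the concatenation of paths, the paths outside of `B` being zero. The homology depends only on this
structure, not on the presentation as a quotient of the path algebra. -/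
structure MonomialModel (k : Type u) [Field k] {V : Type v} [Quiver.{w} V] (Z : Set (QPath V))
    (A : Type*) [Ring A] [Algebra k A] where
  /-- the element of the algebra given by a path -/
  ofPath : ∀ {a b : V}, Path a b → A
  mul : ∀ {a b c : V} (p : Path a b) (q : Path b c), ofPath q * ofPath p = ofPath (p.comp q)
  mul_of_ne : ∀ {a b b' c : V} (p : Path a b) (q : Path b' c), b ≠ b' → ofPath q * ofPath p = 0
  eq_zero : ∀ {a b : V} {p : Path a b}, (⟨a, b, p⟩ : QPath V) ∉ basisPaths Z → ofPath p = 0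
  /-- the basis -/
  basis : Module.Basis (basisPaths Z) k A
  basis_apply : ∀ α : basisPaths Z, basis α = ofPath α.1.path

/-- The monomial algebra as a model of itself. -/
noncomputable def MonomialAlgebra.model (k : Type u) [Field k] {V : Type v} [Quiver.{w} V]
    [Fintype V] (Z : Set (QPath V)) : MonomialModel k Z (MonomialAlgebra k Z) where
  ofPath := MonomialAlgebra.ofPath k Z
  mul := MonomialAlgebra.ofPath_mul
  mul_of_ne := MonomialAlgebra.ofPath_mul_of_ne
  eq_zero := MonomialAlgebra.ofPath_eq_zero
  basis := Module.Basis.mk MonomialAlgebra.linearIndependent_ofPath MonomialAlgebra.span_ofPath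
  basis_apply α := by rw [Module.Basis.mk_apply]

namespace MonomialModel

variable {k : Type u} [Field k] {V : Type v} [Quiver.{w} V] {Z : Set (QPath V)}
  {A : Type*} [Ring A] [Algebra k A] (M : MonomialModel k Z A)

theorem mul_nil {a b : V} (p : Path a b) :
    M.ofPath p * M.ofPath (Path.nil : Path a a) = M.ofPath p := by
  rw [M.mul, Path.nil_comp]

theorem nil_mul {a b : V} (p : Path a b) :
    M.ofPath (Path.nil : Path b b) * M.ofPath p = M.ofPath p := by
  rw [M.mul, Path.comp_nil]

variable {X : Type*} [AddCommGroup X] [Module k X]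

theorem hom_ext {f g : A →ₗ[k] X}
    (h : ∀ (a b : V) (p : Path a b), f (M.ofPath p) = g (M.ofPath p)) : f = g :=
  M.basis.ext fun α => by rw [M.basis_apply]; exact h _ _ _

/-- The linear map with given values on the paths of `B`; the values of `f` elsewhere are ignored. -/
noncomputable def lift (f : QPath V → X) : A →ₗ[k] X := M.basis.constr k fun α => f α.1

theorem lift_ofPath {f : QPath V → X} (hf : ∀ α ∉ basisPaths Z, f α = 0) {a b : V}
    (p : Path a b) : M.lift f (M.ofPath p) = f ⟨a, b, p⟩ := by
  by_cases h : (⟨a, b, p⟩ : QPath V) ∈ basisPaths Z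
  · have e := M.basis_apply ⟨_, h⟩
    dsimp only at e
    rw [← e, lift, Module.Basis.constr_basis]
  · rw [M.eq_zero h, map_zero, hf _ h]

theorem finite_basisPaths (M : MonomialModel k Z A) [Module.Finite k A] : (basisPaths Z).Finite :=
  Module.Finite.finite_basis M.basis

end MonomialModel

/-! ### The degree one part of the Hochschild complex modulo boundaries -/

section HochschildCoker

open TensorProduct

variable {k : Type u} {A : Type v} [Field k] [Ring A] [Algebra k A]

variable (k) in
/-- The class of `a ⊗ b` modulo the image of `A ⊗ A ⊗ A`. It can be thought of as the class of the
differential form `a db` modulo commutators. -/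
noncomputable def formClass (a b : A) : A ⊗[k] A ⧸ LinearMap.range (hochschildB₂ k A) :=
  (LinearMap.range (hochschildB₂ k A)).mkQ (a ⊗ₜ b)

theorem formClass_mul (a b c : A) :
    formClass k a (b * c) = formClass k (a * b) c + formClass k (c * a) b := by
  have h : (LinearMap.range (hochschildB₂ k A)).mkQ (hochschildB₂ k A (a ⊗ₜ b ⊗ₜ c)) = 0 :=
    (Submodule.Quotient.mk_eq_zero _).2 ⟨_, rfl⟩
  rw [hochschildB₂_tmul, map_add, map_sub] at h
  simp only [formClass]
  rw [← sub_eq_zero, ← neg_eq_zero, ← h]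
  abel

theorem formClass_zero_left (b : A) : formClass k 0 b = 0 := by
  rw [formClass, TensorProduct.zero_tmul, map_zero]

theorem formClass_zero_right (a : A) : formClass k a 0 = 0 := by
  rw [formClass, TensorProduct.tmul_zero, map_zero]

theorem formClass_eq_zero {x e : A} (he : e * e = e) (h₁ : x * e = x) (h₂ : e * x = x) :
    formClass k x e = 0 := by
  have h := formClass_mul (k := k) x e e
  rw [he, h₁, h₂] at h
  simpa using h

theorem hochschildB₁_eq_of_mkQ_eq {x y : A ⊗[k] A}
    (h : (LinearMap.range (hochschildB₂ k A)).mkQ x =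
      (LinearMap.range (hochschildB₂ k A)).mkQ y) :
    hochschildB₁ k A x = hochschildB₁ k A y := by
  obtain ⟨z, hz⟩ := (Submodule.Quotient.eq _).1 h
  rw [← sub_eq_zero, ← map_sub, ← hz]
  exact LinearMap.congr_fun (hochschildB₁_comp_hochschildB₂ k A) z

end HochschildCoker

/-! ### The first Hochschild homology in terms of cycles -/

section Homology

open TensorProduct

variable {k : Type u} [Field k] {V : Type v} [Quiver.{w} V]

variable (k) in
open Classical in
/-- The basis vector of a cycle `a q` with `a` an arrow and `q` in `B`; zero for other cycles. -/
noncomputable def arrowClass (Z : Set (QPath V)) (γ : QCycle V) : arrowCycles Z →₀ k :=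
  if h : γ ∈ arrowCycles Z then Finsupp.single ⟨γ, h⟩ 1 else 0

variable (k) in
/-- The sum of the first `n` rotations of a cycle. -/
noncomputable def arrowSum (Z : Set (QPath V)) (γ : QCycle V) (n : ℕ) : arrowCycles Z →₀ k :=
  ∑ i ∈ Finset.range n, arrowClass k Z (QCycle.rotate^[i] γ)

variable (k) in
/-- The span of the sums of all rotations of the cycles which are not in `B`. It is the image of the
differential `k (Z ⊙ B) → k (Q₁ ⊙ B)` of the minimal complex. -/
noncomputable def normSpan (Z : Set (QPath V)) : Submodule k (arrowCycles Z →₀ k) :=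
  Submodule.span k ((fun γ : QCycle V => arrowSum k Z γ γ.2.length) ''
    {γ | γ.toQPath ∉ basisPaths Z})

variable {Z : Set (QPath V)}

theorem arrowClass_of_notMem {γ : QCycle V} (h : γ ∉ arrowCycles Z) : arrowClass k Z γ = 0 :=
  dif_neg h

theorem arrowClass_of_mem {γ : QCycle V} (h : γ ∈ arrowCycles Z) :
    arrowClass k Z γ = Finsupp.single ⟨γ, h⟩ 1 :=
  dif_pos h

theorem arrowSum_add (γ : QCycle V) (m n : ℕ) :
    arrowSum k Z γ (m + n) = arrowSum k Z γ m + arrowSum k Z (QCycle.rotate^[m] γ) n := by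
  rw [arrowSum, Finset.sum_range_add]
  refine congrArg (_ + ·) (Finset.sum_congr rfl fun i _ => ?_)
  rw [Nat.add_comm, Function.iterate_add_apply]

theorem arrowSum_comp {a b : V} (p : Path a b) (q : Path b a) (n : ℕ) :
    arrowSum k Z ⟨a, p.comp q⟩ (q.length + n) =
      arrowSum k Z ⟨a, p.comp q⟩ q.length + arrowSum k Z ⟨b, q.comp p⟩ n := by
  rw [arrowSum_add, QCycle.iterate_rotate_comp]

theorem iterate_rotate_notMem_arrowCycles {a b : V} {p : Path a b}
    (hp : (⟨a, b, p⟩ : QPath V) ∉ basisPaths Z) (q : Path b a) {i : ℕ} (hi : i < q.length) :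
    QCycle.rotate^[i] ⟨a, p.comp q⟩ ∉ arrowCycles Z := by
  suffices H : ∀ {c : V} (q : Path b c) (i : ℕ) (p : Path c b),
      i < q.length → (⟨c, b, p⟩ : QPath V) ∉ basisPaths Z →
      QCycle.rotate^[i] ⟨c, p.comp q⟩ ∉ arrowCycles Z from H q i p hi hp
  clear hi hp q p i a
  intro c q
  induction q with
  | nil => intro i p hi; exact absurd hi (Nat.not_lt_zero _)
  | cons q e ih =>
    rintro (_ | i) p hi hp
    · rw [Function.iterate_zero_apply, Path.comp_cons, mk_cons_mem_arrowCycles]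
      exact fun h => hp (mem_basisPaths_of_comp_left h)
    · rw [Function.iterate_succ_apply, Path.comp_cons, QCycle.rotate_cons, ← Path.comp_assoc]
      exact ih i _ (Nat.lt_of_succ_lt_succ hi) fun h => hp (mem_basisPaths_of_comp_right h)

theorem arrowSum_comp_eq_zero {a b : V} {p : Path a b}
    (hp : (⟨a, b, p⟩ : QPath V) ∉ basisPaths Z) (q : Path b a) :
    arrowSum k Z ⟨a, p.comp q⟩ q.length = 0 :=
  Finset.sum_eq_zero fun _ hi =>
    arrowClass_of_notMem (iterate_rotate_notMem_arrowCycles hp q (Finset.mem_range.1 hi))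

theorem arrowSum_comp_mem_normSpan {a b : V} (p : Path a b) {q : Path b a}
    (hq : (⟨b, a, q⟩ : QPath V) ∉ basisPaths Z) :
    arrowSum k Z ⟨a, p.comp q⟩ q.length ∈ normSpan k Z := by
  have h : arrowSum k Z ⟨a, p.comp q⟩ (p.comp q).length ∈ normSpan k Z :=
    Submodule.subset_span ⟨⟨a, p.comp q⟩, fun h => hq (mem_basisPaths_of_comp_right h), rfl⟩
  rwa [Path.length_comp, Nat.add_comm, arrowSum_comp, arrowSum_comp_eq_zero hq, add_zero] at h

variable (k Z) in
open Classical in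
/-- The class of `α dβ`, for two paths `α` and `β`, in the cokernel of the differential
`k (Z ⊙ B) → k (Q₁ ⊙ B)`: it is `∑ (a, β' α β'')` over the decompositions `β = β'' a β'` with `a`
an arrow, if `α` and `β` form a cycle, and zero otherwise. -/
noncomputable def cyclicSum (α β : QPath V) : (arrowCycles Z →₀ k) ⧸ normSpan k Z :=
  if h : α.tgt = β.src ∧ β.tgt = α.src then
    (normSpan k Z).mkQ
      (arrowSum k Z ⟨α.src, α.path.comp (β.path.cast h.1.symm h.2)⟩ β.path.length)
  else 0

theorem cyclicSum_mk {a b : V} (p : Path a b) (q : Path b a) :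
    cyclicSum k Z ⟨a, b, p⟩ ⟨b, a, q⟩ =
      (normSpan k Z).mkQ (arrowSum k Z ⟨a, p.comp q⟩ q.length) :=
  dif_pos ⟨rfl, rfl⟩

theorem cyclicSum_of_not {α β : QPath V} (h : ¬ (α.tgt = β.src ∧ β.tgt = α.src)) :
    cyclicSum k Z α β = 0 :=
  dif_neg h

theorem cyclicSum_eq_zero_left {α : QPath V} (hα : α ∉ basisPaths Z) (β : QPath V) :
    cyclicSum k Z α β = 0 := by
  by_cases h : α.tgt = β.src ∧ β.tgt = α.src
  · obtain ⟨a, b, p⟩ := α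
    obtain ⟨c, d, q⟩ := β
    obtain ⟨h₁, h₂⟩ := h
    dsimp only at h₁ h₂
    subst h₁ h₂
    rw [cyclicSum_mk, arrowSum_comp_eq_zero hα, map_zero]
  · exact cyclicSum_of_not h

theorem cyclicSum_eq_zero_right (α : QPath V) {β : QPath V} (hβ : β ∉ basisPaths Z) :
    cyclicSum k Z α β = 0 := by
  by_cases h : α.tgt = β.src ∧ β.tgt = α.src
  · obtain ⟨a, b, p⟩ := α
    obtain ⟨c, d, q⟩ := β
    obtain ⟨h₁, h₂⟩ := h
    dsimp only at h₁ h₂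
    subst h₁ h₂
    rw [cyclicSum_mk]
    exact (Submodule.Quotient.mk_eq_zero _).2 (arrowSum_comp_mem_normSpan p hβ)
  · exact cyclicSum_of_not h

end Homology

section Model

open TensorProduct

namespace MonomialModel

variable {k : Type u} [Field k] {V : Type v} [Quiver.{w} V] {Z : Set (QPath V)}
  {A : Type*} [Ring A] [Algebra k A] (M : MonomialModel k Z A)

/-- The bilinear map `(α, β) ↦ cyclicSum α β` on the monomial algebra, as a linear map on
`A ⊗ A`. -/
noncomputable def ofTensor :
    A ⊗[k] A →ₗ[k] (arrowCycles Z →₀ k) ⧸ normSpan k Z :=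
  TensorProduct.lift <| M.lift fun α => M.lift fun β => cyclicSum k Z α β

theorem ofTensor_ofPath {a b c d : V} (p : Path a b) (q : Path c d) :
    M.ofTensor (M.ofPath p ⊗ₜ M.ofPath q) = cyclicSum k Z ⟨a, b, p⟩ ⟨c, d, q⟩ := by
  rw [ofTensor, TensorProduct.lift.tmul, M.lift_ofPath, M.lift_ofPath]
  · exact fun β hβ => cyclicSum_eq_zero_right _ hβ
  · intro α hα
    refine M.hom_ext fun a b p => ?_
    rw [M.lift_ofPath fun β hβ => cyclicSum_eq_zero_right _ hβ, cyclicSum_eq_zero_left hα,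
      LinearMap.zero_apply]

theorem ofTensor_hochschild_ofPath {a b c d e f : V} (p : Path a b) (q : Path c d)
    (r : Path e f) :
    M.ofTensor (hochschildB₂ k A (M.ofPath p ⊗ₜ
      M.ofPath q ⊗ₜ M.ofPath r)) = 0 := by
  rw [hochschildB₂_tmul, map_add, map_sub]
  by_cases h₁ : d = a
  · by_cases h₂ : f = c
    · by_cases h₃ : b = e
      · subst h₁ h₂ h₃
        rw [M.mul, M.mul, M.mul,
          ofTensor_ofPath, ofTensor_ofPath, ofTensor_ofPath, cyclicSum_mk, cyclicSum_mk,
          cyclicSum_mk, Path.length_comp, Nat.add_comm r.length, ← Path.comp_assoc,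
          arrowSum_comp, map_add, ← Path.comp_assoc]
        abel
      · subst h₁ h₂
        rw [M.mul, M.mul,
          M.mul_of_ne p r h₃, TensorProduct.zero_tmul, map_zero,
          ofTensor_ofPath, ofTensor_ofPath, cyclicSum_of_not (fun h => h₃ h.1),
          cyclicSum_of_not (fun h => h₃ h.1), sub_zero, add_zero]
    · rw [M.mul_of_ne r q h₂, TensorProduct.tmul_zero, map_zero]
      subst h₁
      rw [M.mul, ofTensor_ofPath, cyclicSum_of_not (fun h => h₂ h.2)]
      by_cases h₃ : b = e
      · subst h₃
        rw [M.mul, ofTensor_ofPath, cyclicSum_of_not (fun h => h₂ h.1),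
          sub_zero, add_zero]
      · rw [M.mul_of_ne p r h₃, TensorProduct.zero_tmul, map_zero, sub_zero,
          add_zero]
  · rw [M.mul_of_ne q p h₁, TensorProduct.zero_tmul, map_zero]
    have e₁ : M.ofTensor (M.ofPath p ⊗ₜ
        (M.ofPath q * M.ofPath r)) = 0 := by
      by_cases h₂ : f = c
      · subst h₂
        rw [M.mul, ofTensor_ofPath, cyclicSum_of_not (fun h => h₁ h.2)]
      · rw [M.mul_of_ne r q h₂, TensorProduct.tmul_zero, map_zero]
    have e₂ : M.ofTensor ((M.ofPath r * M.ofPath p) ⊗ₜ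
        M.ofPath q) = 0 := by
      by_cases h₃ : b = e
      · subst h₃
        rw [M.mul, ofTensor_ofPath, cyclicSum_of_not (fun h => h₁ h.2)]
      · rw [M.mul_of_ne p r h₃, TensorProduct.zero_tmul, map_zero]
    rw [e₁, e₂, sub_zero, add_zero]

theorem ofTensor_comp_hochschildB₂ :
    M.ofTensor ∘ₗ hochschildB₂ k A = 0 := by
  refine TensorProduct.ext (TensorProduct.ext (M.hom_ext fun a b p => M.hom_ext fun c d q =>
    M.hom_ext fun e f r => ?_))
  exact M.ofTensor_hochschild_ofPath p q r

/-- The element `q ⊗ a` of `A ⊗ A` attached to a cycle `a q` with `a` an arrow. -/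
noncomputable def cycleTensor : QCycle V → A ⊗[k] A
  | ⟨_, .nil⟩ => 0
  | ⟨_, .cons q e⟩ => M.ofPath q ⊗ₜ M.ofPath e.toPath

theorem cycleTensor_cons {a b : V} (q : Path a b) (e : b ⟶ a) :
    M.cycleTensor ⟨a, q.cons e⟩ =
      M.ofPath q ⊗ₜ M.ofPath e.toPath := rfl

/-- The linear map `(a, q) ↦ q ⊗ a` from `k (Q₁ ⊙ B)` to `A ⊗ A`. -/
noncomputable def toTensor :
    (arrowCycles Z →₀ k) →ₗ[k] A ⊗[k] A :=
  Finsupp.linearCombination k fun γ => M.cycleTensor γ.1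

theorem toTensor_arrowClass (γ : QCycle V) :
    M.toTensor (arrowClass k Z γ) = M.cycleTensor γ := by
  by_cases h : γ ∈ arrowCycles Z
  · rw [arrowClass_of_mem h, toTensor, Finsupp.linearCombination_single, one_smul]
  · rw [arrowClass_of_notMem h, map_zero]
    obtain ⟨a, p⟩ := γ
    cases p with
    | nil => rfl
    | cons q e =>
      rw [mk_cons_mem_arrowCycles] at h
      rw [cycleTensor_cons, M.eq_zero h, TensorProduct.zero_tmul]

theorem ofTensor_cycleTensor (γ : QCycle V) :
    M.ofTensor (M.cycleTensor γ) = (normSpan k Z).mkQ (arrowClass k Z γ) := by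
  obtain ⟨a, p⟩ := γ
  cases p with
  | nil =>
    rw [arrowClass_of_notMem (mk_nil_notMem_arrowCycles a), map_zero]
    exact map_zero _
  | cons q e =>
    rw [cycleTensor_cons, ofTensor_ofPath, cyclicSum_mk, Path.length_toPath, arrowSum,
      Finset.sum_range_one]
    rfl

theorem ofTensor_toTensor (x : arrowCycles Z →₀ k) :
    M.ofTensor (M.toTensor x) = (normSpan k Z).mkQ x := by
  have : M.ofTensor ∘ₗ M.toTensor = (normSpan k Z).mkQ := by
    refine Finsupp.lhom_ext' fun γ => LinearMap.ext_ring ?_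
    have h := arrowClass_of_mem (k := k) γ.2
    simp only [LinearMap.comp_apply, Finsupp.lsingle_apply]
    rw [← h, toTensor_arrowClass, ofTensor_cycleTensor]
  exact LinearMap.congr_fun this x

theorem formClass_ofPath_nil {a : V} (p : Path a a) :
    formClass k (M.ofPath p) (M.ofPath (Path.nil : Path a a)) = 0 :=
  formClass_eq_zero (M.mul_nil _) (M.mul_nil p) (M.nil_mul p)

/-- The iterated Leibniz rule: `α d(aₙ ⋯ a₁) = ∑ aᵢ₋₁ ⋯ a₁ α aₙ ⋯ aᵢ₊₁ daᵢ` modulo commutators. -/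
theorem mkQ_toTensor_arrowSum {a b : V} (p : Path a b) (q : Path b a) :
    (LinearMap.range (hochschildB₂ k A)).mkQ
      (M.toTensor (arrowSum k Z ⟨a, p.comp q⟩ q.length)) =
    formClass k (M.ofPath p) (M.ofPath q) := by
  suffices H : ∀ {c : V} (q : Path b c) (p : Path c b),
      (LinearMap.range (hochschildB₂ k A)).mkQ
        (M.toTensor (arrowSum k Z ⟨c, p.comp q⟩ q.length)) =
      formClass k (M.ofPath p) (M.ofPath q) from H q p
  clear p q a
  intro c q
  induction q with
  | nil =>
    intro p
    rw [formClass_ofPath_nil, Path.length_nil, arrowSum, Finset.sum_range_zero, map_zero, map_zero]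
  | cons q e ih =>
    intro p
    have h := ih (e.toPath.comp p)
    rw [Path.length_cons, Nat.add_comm, arrowSum_add, map_add, map_add, Function.iterate_one,
      Path.comp_cons, QCycle.rotate_cons, ← Path.comp_assoc, h, arrowSum, Finset.sum_range_one,
      Function.iterate_zero_apply, toTensor_arrowClass, cycleTensor_cons]
    have e₁ := formClass_mul (k := k) (M.ofPath p)
      (M.ofPath e.toPath) (M.ofPath q)
    rw [M.mul q e.toPath, M.mul e.toPath p,
      M.mul p q] at e₁
    exact (add_comm _ _).trans e₁.symm

theorem mkQ_toTensor_of_mem_normSpan {x : arrowCycles Z →₀ k} (hx : x ∈ normSpan k Z) :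
    (LinearMap.range (hochschildB₂ k A)).mkQ (M.toTensor x) = 0 := by
  have : normSpan k Z ≤ LinearMap.ker
      ((LinearMap.range (hochschildB₂ k A)).mkQ ∘ₗ M.toTensor) := by
    rw [normSpan, Submodule.span_le]
    rintro _ ⟨⟨a, p⟩, hγ, rfl⟩
    have h := M.mkQ_toTensor_arrowSum Path.nil p
    rw [Path.nil_comp, M.eq_zero hγ, formClass_zero_right] at h
    exact h
  exact this hx

/-- The map induced by `toTensor` modulo boundaries. -/
noncomputable def toTensorQuot : ((arrowCycles Z →₀ k) ⧸ normSpan k Z) →ₗ[k]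
    A ⊗[k] A ⧸
      LinearMap.range (hochschildB₂ k A) :=
  (normSpan k Z).liftQ
    ((LinearMap.range (hochschildB₂ k A)).mkQ ∘ₗ M.toTensor)
    fun _ hx => M.mkQ_toTensor_of_mem_normSpan hx

theorem toTensorQuot_mkQ (x : arrowCycles Z →₀ k) :
    M.toTensorQuot ((normSpan k Z).mkQ x) =
      (LinearMap.range (hochschildB₂ k A)).mkQ (M.toTensor x) := rfl

/-- The differential `k (Q₁ ⊙ B) → A`, which sends `(a, q)` to `qa - aq`. -/
noncomputable def arrowDifferential : (arrowCycles Z →₀ k) →ₗ[k] A :=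
  hochschildB₁ k A ∘ₗ M.toTensor

theorem normSpan_le_ker : normSpan k Z ≤ LinearMap.ker M.arrowDifferential := by
  intro x hx
  rw [LinearMap.mem_ker, arrowDifferential, LinearMap.comp_apply,
    hochschildB₁_eq_of_mkQ_eq ((M.mkQ_toTensor_of_mem_normSpan hx).trans (map_zero _).symm), map_zero]

/-- The map from the cycles of `k (Q₁ ⊙ B)` to the first Hochschild homology. -/
noncomputable def kerToHH₁ :
    LinearMap.ker M.arrowDifferential →ₗ[k] HH₁ k A :=
  Submodule.mkQ _ ∘ₗ
    ((M.toTensor ∘ₗ (LinearMap.ker M.arrowDifferential).subtype).codRestrict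
      (LinearMap.ker (hochschildB₁ k A)) fun x => x.2)

theorem ker_kerToHH₁ :
    LinearMap.ker M.kerToHH₁ =
      (normSpan k Z).submoduleOf (LinearMap.ker M.arrowDifferential) := by
  ext x
  have h₁ : x ∈ LinearMap.ker M.kerToHH₁ ↔
      M.toTensor x.1 ∈ LinearMap.range (hochschildB₂ k A) :=
    Submodule.Quotient.mk_eq_zero _
  have h₂ : x ∈ (normSpan k Z).submoduleOf (LinearMap.ker M.arrowDifferential) ↔
      x.1 ∈ normSpan k Z := Iff.rfl
  rw [h₁, h₂]
  constructor
  · rintro ⟨z, hz⟩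
    have h := M.ofTensor_toTensor x.1
    rw [← hz] at h
    exact (Submodule.Quotient.mk_eq_zero _).1
      (h.symm.trans (LinearMap.congr_fun M.ofTensor_comp_hochschildB₂ z))
  · intro hx
    exact (Submodule.Quotient.mk_eq_zero _).1 (M.mkQ_toTensor_of_mem_normSpan hx)

variable [Fintype V]

/-- The linear map `x ↦ ∑ x eₐ ⊗ eₐ`, over the vertices `a`, modulo boundaries. It controls the part
of `A ⊗ A` spanned by the pairs of paths which do not form a cycle. -/
noncomputable def vertexForm : A →ₗ[k]
    A ⊗[k] A ⧸
      LinearMap.range (hochschildB₂ k A) :=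
  ∑ a : V, (LinearMap.range (hochschildB₂ k A)).mkQ ∘ₗ
    (TensorProduct.mk k _ _).flip (M.ofPath (Path.nil : Path a a)) ∘ₗ
    LinearMap.mulRight k (M.ofPath (Path.nil : Path a a))

theorem vertexForm_apply (x : A) :
    M.vertexForm x = ∑ a : V, formClass k (x * M.ofPath (Path.nil : Path a a))
      (M.ofPath (Path.nil : Path a a)) := by
  rw [vertexForm, LinearMap.sum_apply]
  rfl

theorem vertexForm_mul_ofPath (x : A) {c d : V} (q : Path c d) :
    M.vertexForm (x * M.ofPath q) =
      formClass k (x * M.ofPath q)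
        (M.ofPath (Path.nil : Path c c)) := by
  rw [vertexForm_apply, Finset.sum_eq_single c]
  · rw [mul_assoc, M.mul_nil]
  · intro b _ hb
    rw [mul_assoc, M.mul_of_ne _ _ hb, mul_zero, formClass_zero_left]
  · simp

theorem toTensorQuot_ofTensor_ofPath {a b c d : V} (p : Path a b) (q : Path c d) :
    M.toTensorQuot (M.ofTensor (M.ofPath p ⊗ₜ M.ofPath q)) +
      M.vertexForm (hochschildB₁ k A
        (M.ofPath p ⊗ₜ M.ofPath q)) =
    formClass k (M.ofPath p) (M.ofPath q) := by
  rw [ofTensor_ofPath, hochschildB₁_tmul, map_sub, vertexForm_mul_ofPath, vertexForm_mul_ofPath]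
  by_cases h₁ : b = c
  · subst h₁
    by_cases h₂ : d = a
    · subst h₂
      rw [cyclicSum_mk, toTensorQuot_mkQ, mkQ_toTensor_arrowSum, M.mul p q,
        M.mul q p, formClass_ofPath_nil, formClass_ofPath_nil, sub_zero,
        add_zero]
    · rw [cyclicSum_of_not (fun h => h₂ h.2), map_zero, M.mul_of_ne q p h₂,
        formClass_zero_left, zero_add, zero_sub]
      -- `p dq = (qp) de` with `e` the vertex at the end of `q`, and `(qp) de = -(qp) de'` with `e'`
      -- the vertex at the start of `p`.
      have e₁ := formClass_mul (k := k) (M.ofPath p)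
        (M.ofPath (Path.nil : Path d d)) (M.ofPath q)
      rw [M.nil_mul q, M.mul_of_ne (Path.nil : Path d d) p h₂,
        formClass_zero_left, zero_add, M.mul p q] at e₁
      have e₂ := formClass_mul (k := k) (M.ofPath (p.comp q))
        (M.ofPath (Path.nil : Path a a))
        (M.ofPath (Path.nil : Path d d))
      rw [M.mul_of_ne (Path.nil : Path d d) (Path.nil : Path a a) h₂,
        formClass_zero_right, M.mul_nil (p.comp q), M.nil_mul (p.comp q)] at e₂
      rw [e₁, M.mul p q, neg_eq_iff_add_eq_zero]
      exact (add_comm _ _).trans e₂.symm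
  · rw [cyclicSum_of_not (fun h => h₁ h.1), map_zero,
      M.mul_of_ne p q h₁, formClass_zero_left]
    have e₁ := formClass_mul (k := k) (M.ofPath p)
      (M.ofPath q) (M.ofPath (Path.nil : Path c c))
    rw [M.mul_nil q, M.mul_of_ne p (Path.nil : Path c c) h₁,
      formClass_zero_left, add_zero] at e₁
    rw [e₁, zero_add, sub_zero]

/-- Up to a term which only depends on the Hochschild differential, each class of `A ⊗ A` modulo
boundaries comes from `k (Q₁ ⊙ B)`. -/
theorem toTensorQuot_ofTensor_add (y : A ⊗[k] A) :
    M.toTensorQuot (M.ofTensor y) +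
      M.vertexForm (hochschildB₁ k A y) =
    (LinearMap.range (hochschildB₂ k A)).mkQ y := by
  have : M.toTensorQuot ∘ₗ M.ofTensor + M.vertexForm ∘ₗ hochschildB₁ k A =
      (LinearMap.range (hochschildB₂ k A)).mkQ := by
    refine TensorProduct.ext (M.hom_ext fun a b p => M.hom_ext
      fun c d q => ?_)
    exact M.toTensorQuot_ofTensor_ofPath p q
  exact LinearMap.congr_fun this y

theorem kerToHH₁_surjective : Function.Surjective M.kerToHH₁ := by
  intro y
  obtain ⟨⟨y, hy⟩, rfl⟩ := Submodule.mkQ_surjective _ y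
  obtain ⟨x, hx⟩ := (normSpan k Z).mkQ_surjective (M.ofTensor y)
  have h := M.toTensorQuot_ofTensor_add y
  rw [LinearMap.mem_ker.1 hy, map_zero, add_zero, ← hx, toTensorQuot_mkQ] at h
  refine ⟨⟨x, ?_⟩, ?_⟩
  · rw [LinearMap.mem_ker, arrowDifferential, LinearMap.comp_apply, hochschildB₁_eq_of_mkQ_eq h]
    exact hy
  · have h' := (Submodule.Quotient.eq _).1 h
    exact (Submodule.Quotient.eq _).2 h'

theorem rank_HH₁_add_rank_normSpan {A : Type max u v w} [Ring A] [Algebra k A]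
    (M : MonomialModel k Z A) :
    Module.rank k (HH₁ k A) + Module.rank k (normSpan k Z) =
      Module.rank k (LinearMap.ker M.arrowDifferential) := by
  have h := LinearMap.rank_range_add_rank_ker (R := k)
    (M := LinearMap.ker M.arrowDifferential) (M₁ := HH₁ k A) M.kerToHH₁
  rw [ker_kerToHH₁, (Submodule.submoduleOfEquivOfLe M.normSpan_le_ker).rank_eq,
    LinearMap.range_eq_top.2 M.kerToHH₁_surjective, rank_top] at h
  exact h

end MonomialModel

end Model

/-! ### The dimensions of the spaces of cycles and boundaries -/

section FiberwiseConstant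

/-- If `c : S → J` is surjective with finite fibres, then the finitely supported functions on `S`
which are constant on the fibres of `c` are the finitely supported functions on `J`. -/
theorem rank_eq_of_constant_on_fibers {k : Type u} [Field k] {S J : Type v} (c : S → J)
    (hc : Function.Surjective c) (hfin : ∀ j, (c ⁻¹' {j}).Finite) (K : Submodule k (S →₀ k))
    (hK : ∀ x, x ∈ K ↔ ∀ s t, c s = c t → x s = x t) :
    Module.rank k K = Cardinal.lift.{u} (Cardinal.mk J) := by
  classical
  have hsupp : ∀ y : J →₀ k, (Function.support fun s => y (c s)).Finite := by
    intro y
    refine ((y.support.finite_toSet).biUnion fun j _ => hfin j).subset ?_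
    intro s hs
    simp only [Set.mem_iUnion]
    exact ⟨c s, Finsupp.mem_support_iff.2 hs, rfl⟩
  let f : (J →₀ k) →ₗ[k] (S →₀ k) :=
    { toFun := fun y => Finsupp.ofSupportFinite _ (hsupp y)
      map_add' := fun _ _ => by ext; rfl
      map_smul' := fun _ _ => by ext; rfl }
  have hf : Function.Injective f := by
    intro y z h
    ext j
    obtain ⟨s, rfl⟩ := hc j
    exact DFunLike.congr_fun h s
  have hr : LinearMap.range f = K := by
    ext x
    rw [hK]
    constructor
    · rintro ⟨y, rfl⟩ s t h
      exact congrArg y h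
    · intro h
      refine ⟨Finsupp.comapDomain (Function.surjInv hc) x
        (Function.injective_surjInv hc).injOn, ?_⟩
      ext s
      exact h _ _ (Function.surjInv_eq hc _)
  rw [← hr, ← (LinearEquiv.ofInjective f hf).rank_eq, rank_finsupp_self]

end FiberwiseConstant

section Kernel

variable {k : Type u} [Field k] {V : Type v} [Quiver.{w} V] {Z : Set (QPath V)}

theorem QCycle.toQPath_injective : Function.Injective (QCycle.toQPath (V := V)) := by
  rintro ⟨a, p⟩ ⟨b, q⟩ h
  cases h
  rfl

namespace MonomialModel

variable {A : Type*} [Ring A] [Algebra k A] (M : MonomialModel k Z A)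

theorem repr_ofPath [DecidableEq (QPath V)] (δ : basisPaths Z) {a b : V} (p : Path a b) :
    M.basis.repr (M.ofPath p) δ = if ⟨a, b, p⟩ = δ.1 then 1 else 0 := by
  by_cases h : (⟨a, b, p⟩ : QPath V) ∈ basisPaths Z
  · have e := M.basis_apply ⟨_, h⟩
    dsimp only at e
    rw [← e, Module.Basis.repr_self, Finsupp.single_apply]
    simp only [Subtype.ext_iff]
  · rw [M.eq_zero h, map_zero, Finsupp.zero_apply, if_neg]
    intro e
    exact h (e ▸ δ.2)

theorem hochschildB₁_cycleTensor {γ : QCycle V} (hγ : γ ∈ arrowCycles Z) :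
    hochschildB₁ k A (M.cycleTensor γ) = M.ofPath γ.rotate.2 - M.ofPath γ.2 := by
  obtain ⟨a, p⟩ := γ
  cases p with
  | nil => exact absurd hγ (mk_nil_notMem_arrowCycles a)
  | cons q e =>
    rw [cycleTensor_cons, hochschildB₁_tmul, M.mul e.toPath q, M.mul q e.toPath]
    rfl

theorem repr_arrowDifferential_single [DecidableEq (QPath V)] (δ : basisPaths Z)
    (γ : arrowCycles Z) :
    M.basis.repr (M.arrowDifferential (Finsupp.single γ 1)) δ =
      (if γ.1.rotate.toQPath = δ.1 then 1 else 0) - if γ.1.toQPath = δ.1 then 1 else 0 := by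
  rw [arrowDifferential, LinearMap.comp_apply, ← arrowClass_of_mem, toTensor_arrowClass,
    M.hochschildB₁_cycleTensor γ.2, map_sub, Finsupp.sub_apply, repr_ofPath, repr_ofPath]
  rfl

/-- A combination of pairs `(a, q)` is a cycle of the minimal complex when its coefficients at `γ`
and at the preceding rotation of `γ` agree, for each cycle `γ` in `B`. -/
theorem mem_ker_arrowDifferential_iff (x : arrowCycles Z →₀ k) :
    x ∈ LinearMap.ker M.arrowDifferential ↔ ∀ δ (h : δ ∈ basisCycles Z),
      x ⟨QCycle.rotateEquiv.symm δ, symm_rotateEquiv_mem_arrowCycles h⟩ =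
        x ⟨δ, basisCycles_subset_arrowCycles h⟩ := by
  classical
  have h₁ : ∀ δ (h : δ ∈ basisCycles Z), M.basis.repr (M.arrowDifferential x) ⟨δ.toQPath, h.1⟩ =
      x ⟨QCycle.rotateEquiv.symm δ, symm_rotateEquiv_mem_arrowCycles h⟩ -
        x ⟨δ, basisCycles_subset_arrowCycles h⟩ := by
    intro δ h
    have e : Finsupp.lapply ⟨δ.toQPath, h.1⟩ ∘ₗ M.basis.repr.toLinearMap ∘ₗ M.arrowDifferential =
        Finsupp.lapply (R := k) (M := k)
            ⟨QCycle.rotateEquiv.symm δ, symm_rotateEquiv_mem_arrowCycles h⟩ -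
          Finsupp.lapply (R := k) (M := k) ⟨δ, basisCycles_subset_arrowCycles h⟩ := by
      refine Finsupp.lhom_ext' fun γ => LinearMap.ext_ring ?_
      refine (M.repr_arrowDifferential_single _ γ).trans ?_
      simp only [LinearMap.comp_apply, Finsupp.lsingle_apply, LinearMap.sub_apply,
        Finsupp.lapply_apply, Finsupp.single_apply, Subtype.ext_iff, Equiv.eq_symm_apply,
        QCycle.rotateEquiv_apply, QCycle.toQPath_injective.eq_iff]
    exact LinearMap.congr_fun e x
  have h₂ : ∀ δ : basisPaths Z, (¬ ∃ γ ∈ basisCycles Z, γ.toQPath = δ.1) →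
      M.basis.repr (M.arrowDifferential x) δ = 0 := by
    intro δ h
    have e : Finsupp.lapply δ ∘ₗ M.basis.repr.toLinearMap ∘ₗ M.arrowDifferential = 0 := by
      refine Finsupp.lhom_ext' fun γ => LinearMap.ext_ring ?_
      refine (M.repr_arrowDifferential_single _ γ).trans ?_
      have hpos := arrowCycles.length_pos γ.2
      rw [if_neg, if_neg, sub_zero]
      · rfl
      · exact fun e => h ⟨_, ⟨e ▸ δ.2, hpos⟩, e⟩
      · exact fun e => h ⟨_, ⟨e ▸ δ.2, by rwa [QCycle.length_rotate]⟩, e⟩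
    exact LinearMap.congr_fun e x
  rw [LinearMap.mem_ker]
  constructor
  · intro hx δ h
    rw [← sub_eq_zero, ← h₁ δ h, hx, map_zero, Finsupp.zero_apply]
  · intro hx
    refine M.basis.repr.injective (Finsupp.ext fun δ => ?_)
    rw [map_zero, Finsupp.zero_apply]
    by_cases h : ∃ γ ∈ basisCycles Z, γ.toQPath = δ.1
    · obtain ⟨γ, hγ, e⟩ := h
      have := h₁ γ hγ
      rw [hx γ hγ, sub_self] at this
      rw [← this]
      exact congrArg _ (Subtype.ext e.symm)
    · exact h₂ δ h

end MonomialModel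

/-- The outcome of going backwards from `γ` by rotation as long as the cycles are in `B`: either the
first cycle met outside of `B`, which is in `W`, or the circuit of `γ`, if no such cycle is met. -/
def RunsTo (Z : Set (QPath V)) (γ : QCycle V) :
    ↥(arrowCycles Z \ basisCycles Z) ⊕ strongCircuits Z → Prop
  | Sum.inl δ => ∃ n, QCycle.rotateEquiv.symm^[n] γ = δ.1 ∧
      ∀ i < n, QCycle.rotateEquiv.symm^[i] γ ∈ basisCycles Z
  | Sum.inr C => γ.circuit = C.1 ∧ ∀ i, QCycle.rotateEquiv.symm^[i] γ ∈ basisCycles Z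

theorem iterate_symm_mem_arrowCycles {γ : QCycle V} (hγ : γ ∈ arrowCycles Z) {n : ℕ}
    (h : ∀ i < n, QCycle.rotateEquiv.symm^[i] γ ∈ basisCycles Z) :
    QCycle.rotateEquiv.symm^[n] γ ∈ arrowCycles Z := by
  cases n with
  | zero => exact hγ
  | succ n =>
    rw [Function.iterate_succ_apply']
    exact symm_rotateEquiv_mem_arrowCycles (h n n.lt_succ_self)

theorem mk_circuit_mem_strongCircuits {γ : QCycle V}
    (h : ∀ i, QCycle.rotateEquiv.symm^[i] γ ∈ basisCycles Z) : γ.circuit ∈ strongCircuits Z := by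
  refine ⟨fun δ hδ => ?_, fun ht => ?_⟩
  · obtain ⟨i, rfl⟩ := QCycle.exists_iterate_symm_rotateEquiv hδ.symm
    exact (h i).1
  · exact (h 0).2.ne' (Circuit.isTrivial_circuit_iff.1 ht)

theorem existsUnique_runsTo {γ : QCycle V} (hγ : γ ∈ arrowCycles Z) : ∃! j, RunsTo Z γ j := by
  classical
  by_cases h : ∃ i, QCycle.rotateEquiv.symm^[i] γ ∉ basisCycles Z
  · have hmin : ∀ i < Nat.find h, QCycle.rotateEquiv.symm^[i] γ ∈ basisCycles Z :=
      fun i hi => not_not.1 (Nat.find_min h hi)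
    refine ⟨Sum.inl ⟨_, iterate_symm_mem_arrowCycles hγ hmin, Nat.find_spec h⟩,
      ⟨_, rfl, hmin⟩, ?_⟩
    rintro (⟨δ, hδ⟩ | C) hj
    · obtain ⟨n, rfl, hn⟩ := hj
      have : Nat.find h = n := by
        rw [Nat.find_eq_iff]
        exact ⟨hδ.2, fun i hi => not_not.2 (hn i hi)⟩
      subst this
      rfl
    · exact absurd (hj.2 _) (Nat.find_spec h)
  · simp only [not_exists, not_not] at h
    refine ⟨Sum.inr ⟨_, mk_circuit_mem_strongCircuits h⟩, ⟨rfl, h⟩, ?_⟩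
    rintro (⟨δ, hδ⟩ | C) hj
    · obtain ⟨n, rfl, -⟩ := hj
      exact absurd (h n) hδ.2
    · exact congrArg Sum.inr (Subtype.ext hj.1.symm)

theorem RunsTo.of_symm_rotateEquiv {γ : QCycle V} (hγ : γ ∈ basisCycles Z)
    {j : ↥(arrowCycles Z \ basisCycles Z) ⊕ strongCircuits Z}
    (h : RunsTo Z (QCycle.rotateEquiv.symm γ) j) : RunsTo Z γ j := by
  rcases j with δ | C
  · obtain ⟨n, hn, hi⟩ := h
    refine ⟨n + 1, by rwa [Function.iterate_succ_apply], ?_⟩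
    rintro (_ | i) hlt
    · exact hγ
    · rw [Function.iterate_succ_apply]
      exact hi i (Nat.lt_of_succ_lt_succ hlt)
  · refine ⟨by rw [← h.1, QCycle.circuit_symm_rotateEquiv], ?_⟩
    rintro (_ | i)
    · exact hγ
    · rw [Function.iterate_succ_apply]
      exact h.2 i

theorem QCycle.circuit_iterate_symm (n : ℕ) (γ : QCycle V) :
    (QCycle.rotateEquiv.symm^[n] γ).circuit = γ.circuit := by
  induction n with
  | zero => rfl
  | succ n ih => rw [Function.iterate_succ_apply', QCycle.circuit_symm_rotateEquiv, ih]

theorem RunsTo.circuit_eq {γ : QCycle V}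
    {j : ↥(arrowCycles Z \ basisCycles Z) ⊕ strongCircuits Z} (h : RunsTo Z γ j) :
    γ.circuit = Sum.elim (fun δ => δ.1.circuit) (fun C => C.1) j := by
  rcases j with δ | C
  · obtain ⟨n, hn, -⟩ := h
    rw [Sum.elim_inl, ← hn, QCycle.circuit_iterate_symm]
  · exact h.1

theorem apply_iterate_symm_eq {x : arrowCycles Z →₀ k}
    (hx : ∀ δ (h : δ ∈ basisCycles Z),
      x ⟨QCycle.rotateEquiv.symm δ, symm_rotateEquiv_mem_arrowCycles h⟩ =
        x ⟨δ, basisCycles_subset_arrowCycles h⟩) {γ : QCycle V} (hγ : γ ∈ arrowCycles Z) {n : ℕ}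
    (h : ∀ i < n, QCycle.rotateEquiv.symm^[i] γ ∈ basisCycles Z) :
    x ⟨_, iterate_symm_mem_arrowCycles hγ h⟩ = x ⟨γ, hγ⟩ := by
  induction n with
  | zero => rfl
  | succ n ih =>
    rw [← ih fun i hi => h i (hi.trans n.lt_succ_self), ← hx _ (h n n.lt_succ_self)]
    exact congrArg x (Subtype.ext (Function.iterate_succ_apply' _ _ _))

theorem apply_eq_of_runsTo {x : arrowCycles Z →₀ k}
    (hx : ∀ δ (h : δ ∈ basisCycles Z),
      x ⟨QCycle.rotateEquiv.symm δ, symm_rotateEquiv_mem_arrowCycles h⟩ =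
        x ⟨δ, basisCycles_subset_arrowCycles h⟩)
    {γ δ : QCycle V} (hγ : γ ∈ arrowCycles Z) (hδ : δ ∈ arrowCycles Z)
    {j : ↥(arrowCycles Z \ basisCycles Z) ⊕ strongCircuits Z}
    (h : RunsTo Z γ j) (h' : RunsTo Z δ j) : x ⟨γ, hγ⟩ = x ⟨δ, hδ⟩ := by
  rcases j with ε | C
  · obtain ⟨m, hm, hmi⟩ := h
    obtain ⟨n, hn, hni⟩ := h'
    rw [← apply_iterate_symm_eq hx hγ hmi, ← apply_iterate_symm_eq hx hδ hni]
    exact congrArg x (Subtype.ext (hm.trans hn.symm))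
  · obtain ⟨n, hn⟩ := QCycle.exists_iterate_symm_rotateEquiv (h.1.trans h'.1.symm)
    rw [← apply_iterate_symm_eq hx hγ (n := n) fun i _ => h.2 i]
    exact congrArg x (Subtype.ext hn)

/-- The space of cycles has dimension `|W|` plus the number of non trivial strong circuits. -/
theorem MonomialModel.rank_ker_arrowDifferential {A : Type*} [Ring A] [Algebra k A]
    (M : MonomialModel k Z A) :
    Module.rank k (LinearMap.ker M.arrowDifferential) =
      Cardinal.lift.{u} (Cardinal.mk (strongCircuits Z) +
        Cardinal.mk ↥(arrowCycles Z \ basisCycles Z)) := by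
  -- The classes of pairs on which the coefficients of a cycle are constant are the fibres of `c`.
  choose c hc hu using fun γ : arrowCycles Z => existsUnique_runsTo γ.2
  dsimp only at hu
  rw [rank_eq_of_constant_on_fibers c, Cardinal.mk_sum, Cardinal.lift_id, Cardinal.lift_id,
    add_comm]
  · rintro (δ | C)
    · exact ⟨⟨δ.1, δ.2.1⟩, (hu ⟨δ.1, δ.2.1⟩ (Sum.inl δ)
        ⟨0, rfl, fun i hi => absurd hi (Nat.not_lt_zero i)⟩).symm⟩
    · obtain ⟨C, hC, ht⟩ := C
      induction C using Quot.ind with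
      | mk γ =>
        have h : ∀ i, QCycle.rotateEquiv.symm^[i] γ ∈ basisCycles Z := by
          intro i
          have hi := QCycle.circuit_iterate_symm i γ
          refine ⟨hC _ hi, Nat.pos_of_ne_zero fun h0 => ht ?_⟩
          have := Circuit.isTrivial_circuit_iff.2 h0
          rwa [hi] at this
        exact ⟨⟨γ, basisCycles_subset_arrowCycles (h 0)⟩,
          (hu ⟨γ, basisCycles_subset_arrowCycles (h 0)⟩ (Sum.inr ⟨_, hC, ht⟩) ⟨rfl, h⟩).symm⟩
  · intro j
    refine ((finite_circuit (Sum.elim (fun δ => δ.1.circuit) (fun C => C.1) j)).preimage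
      (f := fun γ : arrowCycles Z => γ.1) Subtype.val_injective.injOn).subset ?_
    rintro γ rfl
    exact (hc γ).circuit_eq
  · intro x
    rw [M.mem_ker_arrowDifferential_iff]
    constructor
    · intro hx γ δ h
      exact apply_eq_of_runsTo hx γ.2 δ.2 (hc γ) (h ▸ hc δ)
    · intro hx δ h
      exact hx _ _ (hu _ _ ((hc ⟨_, symm_rotateEquiv_mem_arrowCycles h⟩).of_symm_rotateEquiv h))

end Kernel

section Boundaries

variable (k : Type u) [Field k] {V : Type v} [Quiver.{w} V] (Z : Set (QPath V))

open Classical in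
/-- The sum of the pairs `(a, q)` of `(Q₁ ⊙ B)_C`. -/
noncomputable def circuitSum (C : Circuit V) : arrowCycles Z →₀ k :=
  Finsupp.ofSupportFinite (fun γ => if γ.1.circuit = C then 1 else 0) <|
    ((finite_circuit C).preimage (f := fun γ : arrowCycles Z => γ.1)
      Subtype.val_injective.injOn).subset fun γ hγ => by
        by_contra h
        exact hγ (if_neg h)

variable {k Z}

open Classical in
theorem circuitSum_apply (C : Circuit V) (γ : arrowCycles Z) :
    circuitSum k Z C γ = if γ.1.circuit = C then 1 else 0 := rfl

theorem arrowClass_apply [DecidableEq (QCycle V)] (γ : QCycle V) (δ : arrowCycles Z) :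
    arrowClass k Z γ δ = if γ = δ.1 then 1 else 0 := by
  by_cases h : γ ∈ arrowCycles Z
  · rw [arrowClass_of_mem h, Finsupp.single_apply]
    simp only [Subtype.ext_iff]
  · rw [arrowClass_of_notMem h, Finsupp.zero_apply, if_neg]
    rintro rfl
    exact h δ.2

/-- Summing over all rotations of a cycle counts each cycle of its circuit with the multiplicity of
the circuit. -/
theorem arrowSum_length (γ : QCycle V) :
    arrowSum k Z γ γ.2.length = (γ.circuit.multiplicity : k) • circuitSum k Z γ.circuit := by
  classical
  ext δ
  rw [arrowSum, Finsupp.finsetSum_apply, Finsupp.smul_apply, circuitSum_apply]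
  simp only [arrowClass_apply]
  split_ifs with h
  · rw [Finset.sum_boole, ← Nat.count_eq_card_filter_range, QCycle.count_iterate_rotate h.symm,
      smul_eq_mul, mul_one]
  · rw [smul_zero]
    refine Finset.sum_eq_zero fun i _ => if_neg fun e => h ?_
    rw [← e, QCycle.circuit_iterate_rotate]

theorem normSpan_eq_span_circuitSum (hZ : IsMinimalRelations Z) (p : ℕ) [CharP k p] :
    normSpan k Z = Submodule.span k
      (Set.range fun C : efficientPrimeCircuits p Z => circuitSum k Z C.1) := by
  refine le_antisymm (Submodule.span_le.2 ?_) (Submodule.span_le.2 ?_)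
  · rintro _ ⟨γ, hγ, rfl⟩
    dsimp only
    rw [arrowSum_length]
    by_cases hp : p ∣ γ.circuit.multiplicity
    · rw [(CharP.cast_eq_zero_iff k p _).2 hp, zero_smul]
      exact zero_mem _
    · refine Submodule.smul_mem _ _ ?_
      by_cases hu : ∃ δ ∈ arrowCycles Z, δ.circuit = γ.circuit
      · exact Submodule.subset_span
          ⟨⟨γ.circuit, (isEfficient_iff hZ).2 ⟨fun h => hγ (h γ rfl), hu⟩, hp⟩, rfl⟩
      · have : circuitSum k Z γ.circuit = 0 := by
          ext δ
          exact if_neg fun h => hu ⟨_, δ.2, h⟩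
        rw [this]
        exact zero_mem _
  · rintro _ ⟨⟨C, hC, hp⟩, rfl⟩
    have hs := hC.2.1
    simp only [IsStrong, not_forall] at hs
    obtain ⟨γ, rfl, hγ⟩ := hs
    have hne : (γ.circuit.multiplicity : k) ≠ 0 := fun h => hp ((CharP.cast_eq_zero_iff k p _).1 h)
    have h : arrowSum k Z γ γ.2.length ∈ normSpan k Z := Submodule.subset_span ⟨γ, hγ, rfl⟩
    rw [arrowSum_length] at h
    exact (Submodule.smul_mem_iff _ hne).1 h

theorem linearIndependent_circuitSum (p : ℕ) :
    LinearIndependent k fun C : efficientPrimeCircuits p Z => circuitSum k Z C.1 := by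
  classical
  rw [linearIndependent_iff']
  intro s g hg C hC
  obtain ⟨γ, hγ, hγC⟩ := isUseful_iff.1 C.2.1.1
  have h := DFunLike.congr_fun hg ⟨γ, hγ⟩
  rw [Finsupp.finsetSum_apply, Finset.sum_eq_single C, Finsupp.smul_apply, circuitSum_apply,
    if_pos hγC, smul_eq_mul, mul_one] at h
  · exact h
  · intro D _ hD
    rw [Finsupp.smul_apply, circuitSum_apply, if_neg, smul_zero]
    exact fun e => hD (Subtype.ext (e.symm.trans hγC))
  · exact fun h => absurd hC h

/-- The space of boundaries has the sums over the efficient circuits of multiplicity prime to the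
characteristic as a basis. -/
theorem rank_normSpan (hZ : IsMinimalRelations Z) (p : ℕ) [CharP k p] :
    Module.rank k (normSpan k Z) =
      Cardinal.lift.{u} (Cardinal.mk (efficientPrimeCircuits p Z)) := by
  rw [normSpan_eq_span_circuitSum hZ p,
    ← (linearIndependent_circuitSum (k := k) (Z := Z) p).linearCombinationEquiv.rank_eq,
    rank_finsupp_self]

end Boundaries

/-! ### Cardinalities -/

section Cardinalities

variable {V : Type v} [Quiver.{w} V] {Z : Set (QPath V)}

/-- `W` is the disjoint union of the `W ∩ C`, with `C` an efficient circuit. -/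
theorem sum_mk_endCyclesOn (hZ : IsMinimalRelations Z) :
    (Cardinal.sum fun C : efficientCircuits Z => Cardinal.mk (endCyclesOn Z C.1)) =
      Cardinal.mk ↥(arrowCycles Z \ basisCycles Z) := by
  rw [← Cardinal.mk_sigma, ← endCycles_eq hZ]
  refine Cardinal.mk_congr (Equiv.ofBijective (fun x => ⟨x.2.1, x.2.2.1⟩) ⟨?_, ?_⟩)
  · rintro ⟨⟨C, hC⟩, γ, hγ, hγC⟩ ⟨⟨D, hD⟩, δ, hδ, hδD⟩ h
    obtain rfl : γ = δ := congrArg Subtype.val h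
    dsimp only at hγC hδD
    subst hγC hδD
    rfl
  · rintro ⟨γ, hγ⟩
    exact ⟨⟨⟨γ.circuit, isEfficient_of_mem_diff hZ (endCycles_eq hZ ▸ hγ)⟩, γ, hγ, rfl⟩, rfl⟩

theorem mk_arrowPairs :
    Cardinal.mk (cyclicPairs (arrowPaths V) (basisPaths Z)) =
      Cardinal.mk ↥(arrowCycles Z \ basisCycles Z) + Cardinal.mk (basisCycles Z) := by
  rw [Cardinal.mk_congr arrowPairsEquiv,
    Cardinal.mk_sdiff_add_mk basisCycles_subset_arrowCycles]

theorem mk_vertexPairs [Fintype V] (hZ : IsMinimalRelations Z) :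
    Cardinal.mk (cyclicPairs (vertexPaths V) (basisPaths Z)) =
      (Fintype.card V : Cardinal) + Cardinal.mk (basisCycles Z) := by
  rw [← Cardinal.mk_congr (vertexPairsEquiv hZ), Cardinal.mk_sum, Cardinal.mk_fintype,
    Cardinal.lift_natCast, Cardinal.lift_id']

theorem finite_arrowPairs [Fintype V] [∀ a b : V, Finite (a ⟶ b)] (hB : (basisPaths Z).Finite) :
    (cyclicPairs (arrowPaths V) (basisPaths Z)).Finite := by
  refine (hB.biUnion fun q _ => Set.finite_range fun e : q.tgt ⟶ q.src =>
    (⟨q.tgt, q.src, e.toPath, q.path⟩ : CyclicPair V)).subset ?_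
  rintro ⟨a, b, f, q⟩ ⟨hf, hq⟩
  simp only [Set.mem_iUnion]
  refine ⟨⟨b, a, q⟩, hq, ?_⟩
  cases f with
  | nil => exact absurd hf (by simp [arrowPaths, QPath.length])
  | cons f e =>
    have : f.length = 0 := by simpa [arrowPaths, QPath.length] using hf
    obtain rfl := Path.eq_of_length_zero f this
    obtain rfl := Path.eq_nil_of_length_zero f this
    exact ⟨e, rfl⟩

theorem finite_basisCycles (hB : (basisPaths Z).Finite) : (basisCycles Z).Finite :=
  (hB.preimage QCycle.toQPath_injective.injOn).subset fun _ h => h.1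

theorem finite_vertexPairs [Fintype V] (hZ : IsMinimalRelations Z) (hB : (basisPaths Z).Finite) :
    (cyclicPairs (vertexPaths V) (basisPaths Z)).Finite := by
  have := (finite_basisCycles hB).to_subtype
  exact Set.finite_coe_iff.1 (Finite.of_equiv _ (vertexPairsEquiv hZ))

theorem finite_strongCircuits (hB : (basisPaths Z).Finite) : (strongCircuits Z).Finite := by
  refine ((finite_basisCycles hB).image QCycle.circuit).subset ?_
  rintro C ⟨hC, ht⟩
  induction C using Quot.ind with
  | mk γ =>
    exact ⟨γ, ⟨hC γ rfl, Nat.pos_of_ne_zero fun h => ht (Circuit.isTrivial_circuit_iff.2 h)⟩, rfl⟩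

theorem finite_efficientCircuits (hS : (arrowCycles Z).Finite) : (efficientCircuits Z).Finite := by
  refine (hS.image QCycle.circuit).subset ?_
  intro C hC
  exact isUseful_iff.1 hC.1

theorem finsum_ncard_endCyclesOn (hZ : IsMinimalRelations Z) (hS : (arrowCycles Z).Finite) :
    ∑ᶠ C ∈ efficientCircuits Z, ((endCyclesOn Z C).ncard : ℤ) =
      (arrowCycles Z \ basisCycles Z).ncard := by
  classical
  have hW : (endCycles Z).Finite := by
    rw [endCycles_eq hZ]
    exact hS.subset Set.sdiff_subset
  have hE := finite_efficientCircuits hS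
  rw [← endCycles_eq hZ, finsum_mem_eq_finite_toFinset_sum _ hE, Set.ncard_eq_toFinset_card _ hW,
    Finset.card_eq_sum_card_fiberwise (f := QCycle.circuit) (t := hE.toFinset), Nat.cast_sum]
  · refine Finset.sum_congr rfl fun C _ => congrArg _ ?_
    rw [← Set.ncard_coe_finset]
    congr 1
    ext γ
    simp [endCyclesOn]
  · intro γ hγ
    have hγ' : γ ∈ endCycles Z := by simpa using hγ
    rw [endCycles_eq hZ] at hγ'
    simpa [efficientCircuits] using isEfficient_of_mem_diff hZ hγ'

end Cardinalities

theorem rank_HH₁_add {k : Type u} [Field k] (p : ℕ) [CharP k p] {V : Type v} [Quiver.{w} V]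
    [Fintype V] {Z : Set (QPath V)} (hZ : IsMinimalRelations Z) :
    Module.rank k (HH₁ k (MonomialAlgebra k Z))
        + Cardinal.lift.{u} (Cardinal.mk (efficientPrimeCircuits p Z)) =
      Cardinal.lift.{u} (Cardinal.mk (strongCircuits Z) +
        Cardinal.mk ↥(arrowCycles Z \ basisCycles Z)) := by
  rw [← rank_normSpan (k := k) hZ p,
    (MonomialAlgebra.model k Z).rank_HH₁_add_rank_normSpan,
    MonomialModel.rank_ker_arrowDifferential]

end HochMon

open HochMon
theorem theorem3p5 {k : Type u} [Field k] {p : ℕ} (hp : 0 < p) [CharP k p]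
    {V : Type v} [Quiver.{w} V] [Fintype V] [∀ a b : V, Finite (a ⟶ b)]
    (Z : Set (QPath V)) (hZ : IsMinimalRelations Z) :
    -- finite dimensional monomial algebras: all the sets are finite, and the formulas hold in `ℤ`
    (Module.Finite k (MonomialAlgebra k Z) →
      (strongCircuits Z).Finite ∧ (efficientCircuits Z).Finite ∧
      (cyclicPairs (arrowPaths V) (basisPaths Z)).Finite ∧
      (cyclicPairs (vertexPaths V) (basisPaths Z)).Finite ∧
      Module.Finite k (HH₁ k (MonomialAlgebra k Z)) ∧
      (Module.finrank k (HH₁ k (MonomialAlgebra k Z)) : ℤ)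
        = (strongCircuits Z).ncard
          + ∑ᶠ C ∈ efficientCircuits Z, ((endCyclesOn Z C).ncard : ℤ)
          - (efficientPrimeCircuits p Z).ncard ∧
      (Module.finrank k (HH₁ k (MonomialAlgebra k Z)) : ℤ)
        = (cyclicPairs (arrowPaths V) (basisPaths Z)).ncard
          - (cyclicPairs (vertexPaths V) (basisPaths Z)).ncard
          + Fintype.card V
          - (efficientPrimeCircuits p Z).ncard
          + (strongCircuits Z).ncard) ∧
    -- arbitrary monomial algebras: the same formulas between cardinals, without subtraction
    (Module.rank k (HH₁ k (MonomialAlgebra k Z))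
        + Cardinal.lift.{u} (Cardinal.mk (efficientPrimeCircuits p Z))
      = Cardinal.lift.{u} (Cardinal.mk (strongCircuits Z)
        + Cardinal.sum fun C : efficientCircuits Z => Cardinal.mk (endCyclesOn Z C.1))) ∧
    (Module.rank k (HH₁ k (MonomialAlgebra k Z))
        + Cardinal.lift.{u} (Cardinal.mk (cyclicPairs (vertexPaths V) (basisPaths Z))
          + Cardinal.mk (efficientPrimeCircuits p Z))
      = Cardinal.lift.{u} (Cardinal.mk (cyclicPairs (arrowPaths V) (basisPaths Z))
        + (Fintype.card V : Cardinal) + Cardinal.mk (strongCircuits Z))) := by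
  have h₁ := rank_HH₁_add (k := k) p hZ
  have h₂ : Module.rank k (HH₁ k (MonomialAlgebra k Z))
        + Cardinal.lift.{u} (Cardinal.mk (cyclicPairs (vertexPaths V) (basisPaths Z))
          + Cardinal.mk (efficientPrimeCircuits p Z))
      = Cardinal.lift.{u} (Cardinal.mk (cyclicPairs (arrowPaths V) (basisPaths Z))
        + (Fintype.card V : Cardinal) + Cardinal.mk (strongCircuits Z)) := by
    rw [mk_vertexPairs hZ, mk_arrowPairs, Cardinal.lift_add, add_left_comm, h₁,
      ← Cardinal.lift_add]
    congr 1
    ring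
  refine ⟨fun hfin => ?_, by rwa [sum_mk_endCyclesOn hZ], h₂⟩
  have hB := (MonomialAlgebra.model k Z).finite_basisPaths
  have hQ₁ := finite_arrowPairs hB
  have hQ₀ := finite_vertexPairs hZ hB
  have hs := finite_strongCircuits hB
  have hS : (arrowCycles Z).Finite := by
    have := hQ₁.to_subtype
    exact Set.finite_coe_iff.1 (Finite.of_equiv _ arrowPairsEquiv)
  have hE := finite_efficientCircuits hS
  have hE' : (efficientPrimeCircuits p Z).Finite := hE.subset fun C hC => hC.1
  have hW : (arrowCycles Z \ basisCycles Z).Finite := hS.subset Set.sdiff_subset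
  rw [← Set.cast_ncard hE', ← Set.cast_ncard hs, ← Set.cast_ncard hW] at h₁
  rw [← Set.cast_ncard hE', ← Set.cast_ncard hs, ← Set.cast_ncard hQ₁,
    ← Set.cast_ncard hQ₀] at h₂
  have hHH : Module.Finite k (HH₁ k (MonomialAlgebra k Z)) := by
    rw [← Module.rank_lt_aleph0_iff]
    refine (self_le_add_right _ _).trans_lt (h₁.trans_lt ?_)
    rw [← Nat.cast_add, Cardinal.lift_natCast]
    exact Cardinal.natCast_lt_aleph0
  refine ⟨hs, hE, hQ₁, hQ₀, hHH, ?_, ?_⟩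
  · rw [finsum_ncard_endCyclesOn hZ hS]
    rw [← Module.finrank_eq_rank] at h₁
    simp only [← Nat.cast_add, Cardinal.lift_natCast, Nat.cast_inj] at h₁
    omega
  · rw [← Module.finrank_eq_rank] at h₂
    simp only [← Nat.cast_add, Cardinal.lift_natCast, Nat.cast_inj] at h₂
    omega
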